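/- Let $q$ be an odd prime power, $\xi$ a primitive element of $\mathbb F_{q^2}$, and $(X_1,X_2,X_3,X_4)$ homogeneous coordinates of ${\rm PG}(3,q^2)$. For $A\in{\rm SL}(2,q^2)$ let $A^q$ be the matrix obtained by raising all entries of $A$ to the power $q$, and let $K\le{\rm PGL}(4,q^2)$ be the group of projectivities induced by the Kronecker products $A^q\otimes A$, $A\in{\rm SL}(2,q^2)$. Put \[ \mathcal O=\{(1,t,t^q,t^{q+1}) : t\in\mathbb F_{q^2}\}\cup\{(0,0,0,1)\},\qquad \Sigma=\{(a,b,b^q,c) : a,c\in\mathbb F_q,\ b\in\mathbb F_{q^2},\ (a,b,c)\neq(0,0,0)\}, \] let $\mathcal Q^+(3,q^2)$ be the quadric $X_1X_4-X_2X_3=0$, let $\mathcal H(3,q^2)$ be the Hermitian surface $X_1^qX_4+X_1X_4^q-X_2^{q+1}-X_3^{q+1}=0$, and for $\gamma\in\mathbb F_{q^2}$ let $\mathcal C_\gamma$ be the hypersurface \[ X_1^qX_4+X_1X_4^q-X_2^{q+1}-X_3^{q+1}-\gamma\,(X_1X_4-X_2X_3)^{\frac{q+1}{2}}=0 . \] Let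 $\mathcal S_j=\mathcal C_\gamma$ with $\gamma=\xi^{j\frac{q-1}2}+\xi^{-j\frac{q-1}2}$ for $j\in J=\{1,\dots,q\}\setminus\{\frac{q+1}2\}$, and $\mathcal E_k=\mathcal C_\gamma$ with $\gamma=\xi^{k\frac{q+1}2}+\xi^{-k\frac{q+1}2}$ for $k\in\{0,\dots,q-1\}\setminus\{\frac{q-1}2\}$. Let $I=\{1,\dots,q-2\}\setminus\{\frac{q-1}2\}$. Consider the points $S_1=(1,0,0,1)$, $S_2=(1,0,0,\xi^{q+1})$, $U=(0,1,0,0)$, $T_1=(\xi,1,1,0)$, $T_2=(\xi^{q-1},\xi^{q-1},1,0)$, $R_j=(\xi^j,0,0,1)$, $Q_k=(0,\xi^k,1,0)$, and let $\Sigma_1,\Sigma_2,\mathcal H_1,\mathcal H_2$ be the $K$-orbits of $S_1$, $S_2$, $R_{\frac{q+1}2}$, $Q_{\frac{q-1}2}$, respectively. Then $K\cong{\rm PSL}(2,q^2)$, and $K$ has exactly $2q+4$ orbits on the points of ${\rm PG}(3,q^2)$, namely: * $\mathcal O$, of size $q^2+1$; * $\Sigma_1\neq\Sigma_2$, with $\Sigma_1\cup\Sigma_2=\Sigma\setminus\mathcal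 O$, each of size $q(q^2+1)/2$; * $\mathcal Q^+(3,q^2)\setminus\mathcal O$, of size $q^2(q^2+1)$, with representative $U$; * $\mathcal H_1\neq\mathcal H_2$, with $\mathcal H_1\cup\mathcal H_2=\mathcal H(3,q^2)\setminus\mathcal O$, of sizes $q^2(q^2+1)(q-1)/2$ and $q^2(q^2+1)(q+1)/2$, respectively; * for each $j\in J$, the set $\mathcal S_j\setminus\mathcal O$, of size $q^2(q^2+1)(q-1)/2$, with representative $R_j$; * for each $k\in I$, the set $\mathcal E_k\setminus\mathcal O$, of size $q^2(q^2+1)(q+1)/2$; for $k\in I$ the point $Q_k$ is a representative of $\mathcal E_k\setminus\mathcal O$ if $q\equiv1\pmod 4$, and of $\mathcal E_{q-1-k}\setminus\mathcal O$ if $q\equiv-1\pmod 4$; * $\mathcal E_0\setminus\Sigma$, of size $q(q^4-1)/2$, with representative $T_1$ if $q\equiv1\pmod4$ and $T_2$ if $q\equiv-1\pmod4$; * $\mathcal E_{q-1}\setminus\Sigma$, of size $q(q^4-1)/2$, with representative $T_2$ if $q\equiv1\pmod4$ and $T_1$ if $q\equiv-1\pmod4$. -/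

import Mathlib

open scoped LinearAlgebra.Projectivization MatrixGroups
open MulAction

namespace HermitianVeronese

section Group

variable {F : Type*} [Field F] [Finite F] {q : ℕ}

theorem add_pow_of_card (hF : Nat.card F = q ^ 2) (x y : F) : (x + y) ^ q = x ^ q + y ^ q := by
  obtain ⟨p, hp⟩ := CharP.exists F
  cases nonempty_fintype F
  obtain ⟨n, hprime, hn⟩ := FiniteField.card F p
  rw [Nat.card_eq_fintype_card, hn] at hF
  obtain ⟨k, -, hk⟩ := (Nat.dvd_prime_pow hprime).1 (hF ▸ dvd_pow_self q two_ne_zero)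
  have := Fact.mk hprime
  rw [hk]
  exact add_pow_char_pow x y p k

theorem ne_zero_of_card (hF : Nat.card F = q ^ 2) : q ≠ 0 := by
  rintro rfl
  exact Nat.card_pos.ne' hF

/-- The field homomorphism `x ↦ x ^ q` of the field with `q ^ 2` elements. -/
def frob (hF : Nat.card F = q ^ 2) : F →+* F where
  toFun x := x ^ q
  map_one' := one_pow q
  map_mul' x y := mul_pow x y q
  map_zero' := zero_pow (ne_zero_of_card hF)
  map_add' := add_pow_of_card hF

/-- The homomorphism `SL(2, q ^ 2) → GL(4, q ^ 2)`, `A ↦ A ^ q ⊗ A`, where `A ^ q` is `A` with all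
its entries raised to the power `q` and `⊗` is the Kronecker product; the rows and columns of
the product are indexed lexicographically. -/
def twist (hF : Nat.card F = q ^ 2) : SL(2, F) →* GL (Fin 4) F where
  toFun A := Units.mapEquiv (Matrix.reindexRingEquiv F (finProdFinEquiv : Fin 2 × Fin 2 ≃ Fin 4))
    (Matrix.GeneralLinearGroup.kronecker
      (Matrix.SpecialLinearGroup.toGL (Matrix.SpecialLinearGroup.map (frob hF) A))
      (Matrix.SpecialLinearGroup.toGL A))
  map_one' := by
    rw [map_one, map_one]
    ext i j
    simp [Matrix.GeneralLinearGroup.kronecker, Matrix.one_apply]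
  map_mul' A B := by
    rw [map_mul, map_mul, map_mul, ← map_mul (Units.mapEquiv _)]
    congr 1
    ext1
    exact Matrix.mul_kronecker_mul _ _ _ _

/-- The entries of `A ^ q ⊗ A`, written out. -/
theorem twist_coe (hF : Nat.card F = q ^ 2) (A : SL(2, F)) :
    (twist hF A : Matrix (Fin 4) (Fin 4) F) =
      !![A 0 0 ^ q * A 0 0, A 0 0 ^ q * A 0 1, A 0 1 ^ q * A 0 0, A 0 1 ^ q * A 0 1;
         A 0 0 ^ q * A 1 0, A 0 0 ^ q * A 1 1, A 0 1 ^ q * A 1 0, A 0 1 ^ q * A 1 1;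
         A 1 0 ^ q * A 0 0, A 1 0 ^ q * A 0 1, A 1 1 ^ q * A 0 0, A 1 1 ^ q * A 0 1;
         A 1 0 ^ q * A 1 0, A 1 0 ^ q * A 1 1, A 1 1 ^ q * A 1 0, A 1 1 ^ q * A 1 1] := by
  ext i j
  fin_cases i <;> fin_cases j <;> rfl

/-- The group `K` of the projectivities of `PG(3, q ^ 2)` induced by the matrices `A ^ q ⊗ A`,
`A ∈ SL(2, q ^ 2)`. It acts on points through the action of `PGL(4, q ^ 2)`. -/
def K (hF : Nat.card F = q ^ 2) : Subgroup PGL(4, F) :=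
  (Matrix.ProjGenLinGroup.mk.comp (twist hF)).range

end Group

section Geometry

variable {F : Type*} [Field F]

/-- The points of the three-dimensional projective space over `F`;
`v 0, v 1, v 2, v 3` are the homogeneous coordinates `X₁, X₂, X₃, X₄`. -/
abbrev PG3 (F : Type*) [Field F] : Type _ := ℙ F (Fin 4 → F)

/-- The points of `PG(3, F)` having a coordinate vector in `T`. -/
def pointsOf (T : Set (Fin 4 → F)) : Set (PG3 F) :=
  {P | ∃ (v : Fin 4 → F) (hv : v ≠ 0), v ∈ T ∧ P = Projectivization.mk F v hv}

/-- The Hermitian form `X₁^q X₄ + X₁ X₄^q - X₂^(q+1) - X₃^(q+1)`. -/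
def hermForm (q : ℕ) (v : Fin 4 → F) : F :=
  v 0 ^ q * v 3 + v 0 * v 3 ^ q - v 1 ^ (q + 1) - v 2 ^ (q + 1)

/-- The quadratic form `X₁ X₄ - X₂ X₃`. -/
def quadForm (v : Fin 4 → F) : F := v 0 * v 3 - v 1 * v 2

/-- The Hermitian surface `H(3, q ^ 2)`. -/
def hermSurface (F : Type*) [Field F] (q : ℕ) : Set (PG3 F) := pointsOf {v | hermForm q v = 0}

/-- The hyperbolic quadric `Q⁺(3, q ^ 2)`. -/
def quadric (F : Type*) [Field F] : Set (PG3 F) := pointsOf {v | quadForm v = 0}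

/-- The hypersurface `hermForm = γ * quadForm ^ ((q + 1) / 2)`. -/
def surface (q : ℕ) (γ : F) : Set (PG3 F) :=
  pointsOf {v | hermForm q v - γ * quadForm v ^ ((q + 1) / 2) = 0}

/-- The Hermitian Veronese curve. -/
def O (F : Type*) [Field F] (q : ℕ) : Set (PG3 F) :=
  pointsOf ({v | ∃ t : F, v = ![1, t, t ^ q, t ^ (q + 1)]} ∪ {![0, 0, 0, 1]})

/-- The Baer subgeometry `Σ`; the subfield with `q` elements is `{x | x ^ q = x}`. -/
def Sig (F : Type*) [Field F] (q : ℕ) : Set (PG3 F) :=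
  pointsOf {v | ∃ a b c : F, a ^ q = a ∧ c ^ q = c ∧ v = ![a, b, b ^ q, c]}

/-- The surface `S_j`. -/
def S (q : ℕ) (ξ : Fˣ) (j : ℕ) : Set (PG3 F) :=
  surface q ((ξ : F) ^ (j * ((q - 1) / 2)) + ((ξ : F) ^ (j * ((q - 1) / 2)))⁻¹)

/-- The surface `E_k`. -/
def E (q : ℕ) (ξ : Fˣ) (k : ℕ) : Set (PG3 F) :=
  surface q ((ξ : F) ^ (k * ((q + 1) / 2)) + ((ξ : F) ^ (k * ((q + 1) / 2)))⁻¹)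

/-- The indices of the surfaces `S_j`. -/
def indexS (q : ℕ) : Set ℕ := Set.Icc 1 q \ {(q + 1) / 2}

/-- The indices of the surfaces `E_k` other than `E_0` and `E_{q-1}`. -/
def indexE (q : ℕ) : Set ℕ := Set.Icc 1 (q - 2) \ {(q - 1) / 2}

/-- `S₁ = (1, 0, 0, 1)`. -/
def ptS1 (F : Type*) [Field F] : PG3 F :=
  Projectivization.mk F ![1, 0, 0, 1] (by simp)

/-- `S₂ = (1, 0, 0, ξ^(q+1))`. -/
def ptS2 (q : ℕ) (ξ : Fˣ) : PG3 F :=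
  Projectivization.mk F ![1, 0, 0, (ξ : F) ^ (q + 1)] (by simp)

/-- `U = (0, 1, 0, 0)`. -/
def ptU (F : Type*) [Field F] : PG3 F :=
  Projectivization.mk F ![0, 1, 0, 0] (by simp)

/-- `T₁ = (ξ, 1, 1, 0)`. -/
def ptT1 (ξ : Fˣ) : PG3 F :=
  Projectivization.mk F ![(ξ : F), 1, 1, 0] (by simp)

/-- `T₂ = (ξ^(q-1), ξ^(q-1), 1, 0)`. -/
def ptT2 (q : ℕ) (ξ : Fˣ) : PG3 F :=
  Projectivization.mk F ![(ξ : F) ^ (q - 1), (ξ : F) ^ (q - 1), 1, 0] (by simp)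

/-- `R_j = (ξ^j, 0, 0, 1)`. -/
def ptR (ξ : Fˣ) (j : ℕ) : PG3 F :=
  Projectivization.mk F ![(ξ : F) ^ j, 0, 0, 1] (by simp)

/-- `Q_k = (0, ξ^k, 1, 0)`. -/
def ptQ (ξ : Fˣ) (k : ℕ) : PG3 F :=
  Projectivization.mk F ![0, (ξ : F) ^ k, 1, 0] (by simp)

end Geometry

section Orbits

variable {F : Type*} [Field F] [Finite F] {q : ℕ}

/-- The orbit `Σ₁` of `S₁`. -/
def Sig1 (hF : Nat.card F = q ^ 2) : Set (PG3 F) := orbit (K hF) (ptS1 F)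

/-- The orbit `Σ₂` of `S₂`. -/
def Sig2 (hF : Nat.card F = q ^ 2) (ξ : Fˣ) : Set (PG3 F) := orbit (K hF) (ptS2 q ξ)

/-- The orbit `H₁` of `R_{(q+1)/2}`. -/
def H1 (hF : Nat.card F = q ^ 2) (ξ : Fˣ) : Set (PG3 F) := orbit (K hF) (ptR ξ ((q + 1) / 2))

/-- The orbit `H₂` of `Q_{(q-1)/2}`. -/
def H2 (hF : Nat.card F = q ^ 2) (ξ : Fˣ) : Set (PG3 F) := orbit (K hF) (ptQ ξ ((q - 1) / 2))

end Orbits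

end HermitianVeronese

open HermitianVeronese

namespace HermitianVeronese

/-! ### Homogeneous coordinates and point sets -/

section Coordinates

variable {F : Type*} [Field F] {q : ℕ}

/-! Read a coordinate vector as the 2 × 2 matrix M with rows (X₁, X₂) and (X₃, X₄). Then `A ^ q ⊗ A`
acts by M ↦ σ(A) M Aᵀ, where σ is the `q`-power map. The determinant of M is `quadForm`. The
conjugate transpose M* is transformed by the same rule as M, and `hermForm` is the polarisation of
the determinant evaluated at M and M*. So both forms are invariant, and so is Σ, the set of points
represented by Hermitian matrices. Off the quadric, the quotient `hermForm / quadForm ^ ((q + 1) /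
2)` is a well-defined invariant of points; its level sets are the surfaces C_γ. The square class of
`quadForm` is one more invariant.

The classification is a squeeze. There are 6 + q + (q - 2) = 2q + 4 representatives: (0,0,0,1), S₁,
S₂, U, the points T₁ and T₂ in an order depending on q mod 4, the points R_j, and the points Q_k
reindexed by `twistIndex`. The invariants show that they lie in distinct orbits (`rep_inj`). An
upper bound for each stabilizer in SL(2, q²) (`card_stab_rep_le`) gives a lower bound for each orbit
(`size_le`). These lower bounds add up to the number of points of PG(3, q²) (`sum_size`,
`card_PG3`), so by `orbits_of_card` every bound is sharp and no orbit is missing.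

An invariant set is then the union of the orbits of the representatives it contains
(`IsInv.eq_orbit_union`), so each geometric description reduces to a finite table of memberships
(`rep_mem_quadric`, `rep_mem_Sig`, `rep_mem_surface`). The isomorphism with PSL comes from
`ker_toPGL`. -/

theorem SL_det (A : SL(2, F)) : A 0 0 * A 1 1 - A 0 1 * A 1 0 = 1 := by
  rw [← Matrix.det_fin_two, A.det_coe]

theorem SL_ext {A B : SL(2, F)} (h00 : A 0 0 = B 0 0) (h01 : A 0 1 = B 0 1) (h10 : A 1 0 = B 1 0)
    (h11 : A 1 1 = B 1 1) : A = B := by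
  ext i j
  fin_cases i <;> fin_cases j <;> assumption

theorem quadForm_smul (c : F) (v : Fin 4 → F) : quadForm (c • v) = c ^ 2 * quadForm v := by
  simp only [quadForm, Pi.smul_apply, smul_eq_mul]
  ring

theorem hermForm_smul (c : F) (v : Fin 4 → F) :
    hermForm q (c • v) = c ^ (q + 1) * hermForm q v := by
  simp only [hermForm, Pi.smul_apply, smul_eq_mul]
  ring

theorem mk_mem_pointsOf {T : Set (Fin 4 → F)} {v : Fin 4 → F} (hv : v ≠ 0) :
    Projectivization.mk F v hv ∈ pointsOf T ↔ ∃ c : F, c ≠ 0 ∧ c • v ∈ T := by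
  constructor
  · rintro ⟨w, hw, hT, h⟩
    obtain ⟨c, rfl⟩ := (Projectivization.mk_eq_mk_iff F _ _ hw hv).1 h.symm
    exact ⟨c, c.ne_zero, hT⟩
  · rintro ⟨c, hc, hT⟩
    refine ⟨c • v, smul_ne_zero hc hv, hT, ?_⟩
    rw [Projectivization.mk_eq_mk_iff']
    exact ⟨c⁻¹, by rw [smul_smul, inv_mul_cancel₀ hc, one_smul]⟩

theorem hermSurface_eq : hermSurface F q = surface q 0 := by
  simp [hermSurface, surface]

theorem mk_mem_quadric {v : Fin 4 → F} (hv : v ≠ 0) :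
    Projectivization.mk F v hv ∈ quadric F ↔ quadForm v = 0 := by
  rw [quadric, mk_mem_pointsOf]
  constructor
  · rintro ⟨c, hc, h⟩
    rw [Set.mem_ofPred_eq, quadForm_smul] at h
    exact (mul_eq_zero.1 h).resolve_left (pow_ne_zero _ hc)
  · exact fun h => ⟨1, one_ne_zero, by simpa using h⟩

/-- For odd `q`, `2 * ((q + 1) / 2) = q + 1`, so both sides scale by the same power and any
coordinate vector can be tested. -/
theorem mk_mem_surface (hq : Odd q) {γ : F} {v : Fin 4 → F} (hv : v ≠ 0) :
    Projectivization.mk F v hv ∈ surface q γ ↔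
      hermForm q v = γ * quadForm v ^ ((q + 1) / 2) := by
  rw [surface, mk_mem_pointsOf]
  constructor
  · rintro ⟨c, hc, h⟩
    obtain ⟨m, rfl⟩ := hq
    rw [Set.mem_ofPred_eq, quadForm_smul, hermForm_smul, mul_pow, ← pow_mul,
      show 2 * ((2 * m + 1 + 1) / 2) = 2 * m + 1 + 1 by omega, mul_left_comm, ← mul_sub] at h
    exact sub_eq_zero.1 ((mul_eq_zero.1 h).resolve_left (pow_ne_zero _ hc))
  · exact fun h => ⟨1, one_ne_zero, by simpa [sub_eq_zero] using h⟩

/-- Rescaling multiplies `quadForm` by a square, so its square class belongs to the point. This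
invariant is what tells H₁ from H₂. -/
theorem mk_mem_isSquare {v : Fin 4 → F} (hv : v ≠ 0) :
    Projectivization.mk F v hv ∈ pointsOf {v : Fin 4 → F | IsSquare (quadForm v)} ↔
      IsSquare (quadForm v) := by
  rw [mk_mem_pointsOf]
  constructor
  · rintro ⟨c, hc, y, hy⟩
    rw [quadForm_smul] at hy
    exact ⟨y / c, by field_simp; rw [mul_comm, hy, sq]⟩
  · exact fun h => ⟨1, one_ne_zero, by simpa using h⟩

end Coordinates

/-! ### The action of SL(2, q²) and its invariant sets -/

section Action

variable {F : Type*} [Field F] [Finite F] {q : ℕ}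

theorem frob_apply (hF : Nat.card F = q ^ 2) (x : F) : frob hF x = x ^ q := rfl

theorem frob_frob (hF : Nat.card F = q ^ 2) (x : F) : frob hF (frob hF x) = x := by
  cases nonempty_fintype F
  rw [frob_apply, frob_apply, ← pow_mul, ← sq, ← hF, Nat.card_eq_fintype_card, FiniteField.pow_card]

theorem frob_eq_zero (hF : Nat.card F = q ^ 2) {x : F} : frob hF x = 0 ↔ x = 0 :=
  map_eq_zero _

/-- The action of `A ^ q ⊗ A` on coordinate vectors. -/
def act (hF : Nat.card F = q ^ 2) (A : SL(2, F)) (v : Fin 4 → F) : Fin 4 → F :=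
  let σ := frob hF
  ![σ (A 0 0) * (A 0 0 * v 0 + A 0 1 * v 1) + σ (A 0 1) * (A 0 0 * v 2 + A 0 1 * v 3),
    σ (A 0 0) * (A 1 0 * v 0 + A 1 1 * v 1) + σ (A 0 1) * (A 1 0 * v 2 + A 1 1 * v 3),
    σ (A 1 0) * (A 0 0 * v 0 + A 0 1 * v 1) + σ (A 1 1) * (A 0 0 * v 2 + A 0 1 * v 3),
    σ (A 1 0) * (A 1 0 * v 0 + A 1 1 * v 1) + σ (A 1 1) * (A 1 0 * v 2 + A 1 1 * v 3)]

theorem twist_smul (hF : Nat.card F = q ^ 2) (A : SL(2, F)) (v : Fin 4 → F) :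
    twist hF A • v = act hF A v := by
  change (twist hF A : Matrix (Fin 4) (Fin 4) F).mulVec v = _
  rw [twist_coe]
  ext i
  fin_cases i <;> simp [act, Matrix.mulVec, dotProduct, Fin.sum_univ_four, frob_apply] <;> ring

theorem act_ne_zero (hF : Nat.card F = q ^ 2) (A : SL(2, F)) {v : Fin 4 → F} (hv : v ≠ 0) :
    act hF A v ≠ 0 := by
  rw [← twist_smul]
  exact (smul_ne_zero_iff_ne _).2 hv

/-- The homomorphism from `SL(2, q ^ 2)` onto `K`, with values in `PGL(4, q ^ 2)`. -/
def toPGL (hF : Nat.card F = q ^ 2) : SL(2, F) →* PGL(4, F) :=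
  Matrix.ProjGenLinGroup.mk.comp (twist hF)

theorem toPGL_smul_mk (hF : Nat.card F = q ^ 2) (A : SL(2, F)) {v : Fin 4 → F} (hv : v ≠ 0) :
    toPGL hF A • Projectivization.mk F v hv =
      Projectivization.mk F (act hF A v) (act_ne_zero hF A hv) := by
  simp only [← twist_smul]
  rfl

theorem toPGL_smul_mk_eq_iff (hF : Nat.card F = q ^ 2) (A : SL(2, F)) {v : Fin 4 → F}
    (hv : v ≠ 0) :
    toPGL hF A • Projectivization.mk F v hv = Projectivization.mk F v hv ↔
      ∃ c : F, c ≠ 0 ∧ act hF A v = c • v := by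
  rw [toPGL_smul_mk, Projectivization.mk_eq_mk_iff]
  constructor
  · rintro ⟨c, hc⟩
    exact ⟨c, c.ne_zero, hc.symm⟩
  · rintro ⟨c, hc, h⟩
    exact ⟨Units.mk0 c hc, h.symm⟩

/-- Determinants are multiplicative: det(σ(A) M Aᵀ) = σ(det A) · det M · det A. -/
theorem quadForm_act (hF : Nat.card F = q ^ 2) (A : SL(2, F)) (v : Fin 4 → F) :
    quadForm (act hF A v) = quadForm v := by
  have h := SL_det A
  have h' : frob hF (A 0 0) * frob hF (A 1 1) - frob hF (A 0 1) * frob hF (A 1 0) = 1 := by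
    simpa using congrArg (frob hF) h
  have : quadForm (act hF A v) = (A 0 0 * A 1 1 - A 0 1 * A 1 0) *
      (frob hF (A 0 0) * frob hF (A 1 1) - frob hF (A 0 1) * frob hF (A 1 0)) * quadForm v := by
    simp only [quadForm, act, Matrix.cons_val]
    ring
  rw [this, h, h', one_mul, one_mul]

theorem hermForm_eq (hF : Nat.card F = q ^ 2) (v : Fin 4 → F) :
    hermForm q v = frob hF (v 0) * v 3 + v 0 * frob hF (v 3) - frob hF (v 1) * v 1 -
      frob hF (v 2) * v 2 := by
  simp only [hermForm, frob_apply, pow_succ]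

/-- Since σ² = 1, M* moves by the same rule as M, so the polarised determinant of M and M* is scaled
by the same factor as the determinant itself. -/
theorem hermForm_act (hF : Nat.card F = q ^ 2) (A : SL(2, F)) (v : Fin 4 → F) :
    hermForm q (act hF A v) = hermForm q v := by
  have h := SL_det A
  have h' : frob hF (A 0 0) * frob hF (A 1 1) - frob hF (A 0 1) * frob hF (A 1 0) = 1 := by
    simpa using congrArg (frob hF) h
  have : hermForm q (act hF A v) = (A 0 0 * A 1 1 - A 0 1 * A 1 0) *
      (frob hF (A 0 0) * frob hF (A 1 1) - frob hF (A 0 1) * frob hF (A 1 0)) *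
        hermForm q v := by
    simp only [hermForm_eq hF, act, Matrix.cons_val, map_add, map_mul, frob_frob]
    ring
  rw [this, h, h', one_mul, one_mul]

/-- A set of points is invariant under `K`. -/
def IsInv (hF : Nat.card F = q ^ 2) (X : Set (PG3 F)) : Prop :=
  ∀ (A : SL(2, F)), ∀ P ∈ X, toPGL hF A • P ∈ X

theorem IsInv.pointsOf (hF : Nat.card F = q ^ 2) {T : Set (Fin 4 → F)}
    (hT : ∀ A : SL(2, F), ∀ v ∈ T, act hF A v ∈ T) : IsInv hF (pointsOf T) := by
  rintro A _ ⟨v, hv, hvT, rfl⟩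
  exact ⟨_, act_ne_zero hF A hv, hT A v hvT, toPGL_smul_mk hF A hv⟩

theorem isInv_quadric (hF : Nat.card F = q ^ 2) : IsInv hF (quadric F) :=
  .pointsOf hF fun A v hv => (quadForm_act hF A v).trans hv

theorem isInv_surface (hF : Nat.card F = q ^ 2) (γ : F) : IsInv hF (surface q γ) :=
  .pointsOf hF fun A v hv => by
    rw [Set.mem_ofPred_eq, quadForm_act, hermForm_act]
    exact hv

theorem isInv_isSquare (hF : Nat.card F = q ^ 2) :
    IsInv hF (pointsOf {v | IsSquare (quadForm v)}) :=
  .pointsOf hF fun A v hv => by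
    rw [Set.mem_ofPred_eq, quadForm_act]
    exact hv

theorem isInv_Sig (hF : Nat.card F = q ^ 2) : IsInv hF (Sig F q) := by
  refine .pointsOf hF ?_
  rintro A _ ⟨a, b, c, ha, hc, rfl⟩
  have ha' : frob hF a = a := ha
  have hc' : frob hF c = c := hc
  have hb : b ^ q = frob hF b := rfl
  rw [hb]
  refine ⟨act hF A ![a, b, frob hF b, c] 0, act hF A ![a, b, frob hF b, c] 1,
    act hF A ![a, b, frob hF b, c] 3, ?_, ?_, ?_⟩
  · simp only [← frob_apply hF, act, Matrix.cons_val, map_add, map_mul, frob_frob, ha', hc']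
    ring
  · simp only [← frob_apply hF, act, Matrix.cons_val, map_add, map_mul, frob_frob, ha', hc']
    ring
  · ext i
    fin_cases i
    · rfl
    · rfl
    · simp only [← frob_apply hF, act, Fin.reduceFinMk, Matrix.cons_val, map_add, map_mul,
        frob_frob, ha', hc']
      ring
    · rfl

/-- A multiple of a Hermitian matrix is proportional to its own conjugate transpose; conjugation
swaps coordinates 1 and 2. This serves to exclude points from Σ. -/
theorem exists_of_mk_mem_Sig (hF : Nat.card F = q ^ 2) {v : Fin 4 → F} {hv : v ≠ 0}
    (h : Projectivization.mk F v hv ∈ Sig F q) :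
    ∃ c : F, v 0 ^ q = c * v 0 ∧ v 1 ^ q = c * v 2 ∧ v 2 ^ q = c * v 1 ∧ v 3 ^ q = c * v 3 := by
  obtain ⟨c, hc, a, b, d, ha, hd, h⟩ := (mk_mem_pointsOf hv).1 h
  have hc' : c ^ q ≠ 0 := pow_ne_zero _ hc
  have h0 : c * v 0 = a := congrFun h 0
  have h1 : c * v 1 = b := congrFun h 1
  have h2 : c * v 2 = b ^ q := congrFun h 2
  have h3 : c * v 3 = d := congrFun h 3
  have hb : (b ^ q) ^ q = b := frob_frob hF b
  refine ⟨c / c ^ q, ?_, ?_, ?_, ?_⟩ <;> field_simp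
  · rw [h0, ← mul_pow, mul_comm, h0, ha]
  · rw [h2, ← mul_pow, mul_comm, h1]
  · rw [h1, ← mul_pow, mul_comm, h2, hb]
  · rw [h3, ← mul_pow, mul_comm, h3, hd]

theorem IsInv.inter {hF : Nat.card F = q ^ 2} {X Y : Set (PG3 F)} (hX : IsInv hF X)
    (hY : IsInv hF Y) : IsInv hF (X ∩ Y) :=
  fun A P hP => ⟨hX A P hP.1, hY A P hP.2⟩

theorem IsInv.mem_iff {hF : Nat.card F = q ^ 2} {X : Set (PG3 F)} (hX : IsInv hF X)
    (A : SL(2, F)) (P : PG3 F) : toPGL hF A • P ∈ X ↔ P ∈ X :=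
  ⟨fun h => by simpa [smul_smul, ← map_mul] using hX A⁻¹ _ h, hX A P⟩

theorem IsInv.diff {hF : Nat.card F = q ^ 2} {X Y : Set (PG3 F)} (hX : IsInv hF X)
    (hY : IsInv hF Y) : IsInv hF (X \ Y) :=
  fun A P hP => ⟨hX A P hP.1, fun h => hP.2 ((hY.mem_iff A P).1 h)⟩

theorem mem_orbit_K (hF : Nat.card F = q ^ 2) {P Q : PG3 F} :
    Q ∈ orbit (K hF) P ↔ ∃ A : SL(2, F), toPGL hF A • P = Q := by
  constructor
  · rintro ⟨⟨_, A, rfl⟩, h⟩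
    exact ⟨A, h⟩
  · rintro ⟨A, h⟩
    exact ⟨⟨_, A, rfl⟩, h⟩

theorem IsInv.mem_iff_of_orbit {hF : Nat.card F = q ^ 2} {X : Set (PG3 F)} (hX : IsInv hF X)
    {P Q : PG3 F} (h : Q ∈ orbit (K hF) P) : Q ∈ X ↔ P ∈ X := by
  obtain ⟨A, rfl⟩ := (mem_orbit_K hF).1 h
  exact hX.mem_iff A P

/-- The curve consists of the singular Hermitian matrices: on Σ the quadric reads a c = b^(q+1), so
a = 0 forces b = 0, and otherwise one scales to a = 1 and takes t = b / a. Invariance of the curve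
follows without computation. -/
theorem O_eq (hF : Nat.card F = q ^ 2) : O F q = quadric F ∩ Sig F q := by
  have hq := ne_zero_of_card hF
  ext P
  constructor
  · rintro ⟨v, hv, ⟨t, rfl⟩ | rfl, rfl⟩
    · refine ⟨⟨_, hv, ?_, rfl⟩, ⟨_, hv, ⟨1, t, t ^ (q + 1), one_pow _, ?_, rfl⟩, rfl⟩⟩
      · simp [quadForm, pow_succ, mul_comm]
      · simp only [← frob_apply hF, pow_succ, map_mul, frob_frob, mul_comm]
    · refine ⟨⟨_, hv, ?_, rfl⟩, ⟨_, hv, ⟨0, 0, 1, zero_pow hq, one_pow _, ?_⟩, rfl⟩⟩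
      · simp [quadForm]
      · simp [hq]
  · rintro ⟨h1, v, hv, ⟨a, b, c, ha, hc, rfl⟩, rfl⟩
    rw [mk_mem_quadric] at h1
    rw [O, mk_mem_pointsOf]
    have h1 : a * c - b * b ^ q = 0 := h1
    by_cases h : a = 0
    · have hb : b = 0 := by simpa [h, hq] using h1
      subst h hb
      have hc0 : c ≠ 0 := by
        rintro rfl
        simp [hq] at hv
      refine ⟨c⁻¹, inv_ne_zero hc0, Or.inr ?_⟩
      simp [hq, hc0]
    · refine ⟨a⁻¹, inv_ne_zero h, Or.inl ⟨a⁻¹ * b, ?_⟩⟩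
      have : c = a⁻¹ * (b * b ^ q) := by
        field_simp
        linear_combination h1
      simp [h, mul_pow, ha, this, pow_succ]
      ring

end Action

/-! ### Counting solutions of power and norm equations -/

section Roots

variable {F : Type*} [Field F]

theorem card_pow_eq_le {m : ℕ} (hm : 0 < m) (c : F) : Nat.card {x : F // x ^ m = c} ≤ m := by
  classical
  rw [Nat.subtype_card (Polynomial.nthRoots m c).toFinset
    (fun x => by rw [Multiset.mem_toFinset, Polynomial.mem_nthRoots hm])]
  exact (Multiset.toFinset_card_le _).trans (Polynomial.card_nthRoots m c)

theorem card_pow_add_mul_eq_zero_le {m : ℕ} (hm : 1 < m) (c : F) :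
    Nat.card {x : F // x ^ m + c * x = 0} ≤ m := by
  classical
  let p : Polynomial F := .X ^ m + .C c * .X
  have hp : p.natDegree = m := by
    have : (Polynomial.C c * Polynomial.X).natDegree < m :=
      (Polynomial.natDegree_C_mul_le _ _).trans_lt (by simpa using hm)
    rw [Polynomial.natDegree_add_eq_left_of_natDegree_lt] <;> simp [this]
  have hp0 : p ≠ 0 := by
    rintro h
    rw [h, Polynomial.natDegree_zero] at hp
    omega
  have hroot : ∀ x : F, x ∈ p.roots.toFinset ↔ x ^ m + c * x = 0 := fun x => by
    rw [Multiset.mem_toFinset, Polynomial.mem_roots hp0]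
    simp [p]
  rw [Nat.subtype_card p.roots.toFinset hroot]
  exact (Multiset.toFinset_card_le _).trans ((Polynomial.card_roots' p).trans hp.le)

variable [Finite F]

/-- Surjectivity of the norm onto the nonzero elements of the subfield, with full fibres. A lower
bound is wanted because the next count is small where this one is large. -/
theorem card_norm_eq {q : ℕ} (hF : Nat.card F = q ^ 2) {c : F} (hc : c ^ q = c) (hc0 : c ≠ 0) :
    q + 1 ≤ Nat.card {x : F // x ^ (q + 1) = c} := by
  obtain ⟨g, hg⟩ := IsCyclic.exists_generator (α := Fˣ)
  have hord : orderOf g = q ^ 2 - 1 := by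
    rw [orderOf_eq_card_of_forall_mem_zpowers hg, Nat.card_units, hF]
  have hq0 := ne_zero_of_card hF
  have hq1 : 1 < q := by
    have := Finite.one_lt_card (α := F)
    rw [hF] at this
    by_contra h
    interval_cases q <;> simp_all
  obtain ⟨r, rfl⟩ : ∃ r, q = r + 1 := ⟨q - 1, by omega⟩
  have hr : (r + 1) ^ 2 - 1 = r * (r + 2) := by
    rw [show (r + 1) ^ 2 = r * (r + 2) + 1 by ring, Nat.add_sub_cancel]
  rw [hr] at hord
  obtain ⟨k, hk⟩ := mem_powers_iff_mem_zpowers.2 (hg (Units.mk0 c hc0))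
  have hcu : (Units.mk0 c hc0) ^ r = 1 := by
    ext
    have : c * c ^ r = c * 1 := by rw [mul_one, ← pow_succ', hc]
    simpa using mul_left_cancel₀ hc0 this
  -- With q = r + 1 the generator has order r (r + 2), so c^(q-1) = 1 forces q + 1 = r + 2 to divide
  -- the exponent of c.
  have hk' : r + 2 ∣ k := by
    change g ^ k = _ at hk
    rw [← hk, ← pow_mul, ← orderOf_dvd_iff_pow_eq_one, hord, mul_comm k] at hcu
    exact Nat.dvd_of_mul_dvd_mul_left (by omega) hcu
  obtain ⟨l, rfl⟩ := hk'
  have hk : g ^ ((r + 2) * l) = Units.mk0 c hc0 := hk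
  -- One root is `g ^ l`; the others differ from it by the powers of `g ^ (q - 1)`, which has order
  -- q + 1.
  have hinj : Function.Injective (fun i : Fin (r + 2) =>
      (⟨((g ^ (l + r * i) : Fˣ) : F), by
        rw [← Units.val_pow_eq_pow_val, ← pow_mul, show (l + r * i) * (r + 1 + 1) =
          (r + 2) * l + (r * (r + 2)) * i by ring, pow_add, pow_mul g (r * (r + 2)), ← hord,
          pow_orderOf_eq_one, one_pow, mul_one, hk, Units.val_mk0]⟩ :
        {x : F // x ^ (r + 1 + 1) = c})) := by
    intro i j hij
    simp only [Subtype.mk.injEq, Units.val_inj] at hij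
    rw [pow_add, pow_add, mul_left_cancel_iff] at hij
    have := pow_injOn_Iio_orderOf (x := g) (by
      rw [Set.mem_Iio, hord]
      exact Nat.mul_lt_mul_of_pos_left i.2 (by omega)) (by
      rw [Set.mem_Iio, hord]
      exact Nat.mul_lt_mul_of_pos_left j.2 (by omega)) hij
    exact Fin.ext (Nat.eq_of_mul_eq_mul_left (by omega) this)
  have hle := Nat.card_le_card_of_injective _ hinj
  rwa [Nat.card_fin] at hle

/-- Count by the second coordinate b. A fibre has at most q + 1 points, but only the point a = 0
when ν b^(q+1) = μ, which happens for at least q + 1 values of b. The total is at most (q + 1) + (q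
+ 1)(q² - q - 1) = q (q² - 1). -/
theorem card_norm_add_norm_eq_le {q : ℕ} (hF : Nat.card F = q ^ 2) {ν μ : F} (hν : ν ^ q = ν)
    (hν0 : ν ≠ 0) (hμ : μ ^ q = μ) (hμ0 : μ ≠ 0) :
    Nat.card {p : F × F // p.1 ^ (q + 1) + ν * p.2 ^ (q + 1) = μ} ≤ q * (q ^ 2 - 1) := by
  classical
  cases nonempty_fintype F
  let B : Finset F := {b | b ^ (q + 1) = μ / ν}
  have hB : q + 1 ≤ B.card := by
    refine (card_norm_eq hF (c := μ / ν) (by rw [div_pow, hμ, hν])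
      (div_ne_zero hμ0 hν0)).trans (le_of_eq ?_)
    exact Nat.subtype_card B (fun x => by simp [B])
  have hBc : B.card + Bᶜ.card = q ^ 2 := by
    rw [Finset.card_add_card_compl, ← hF, Nat.card_eq_fintype_card]
  let e : {p : F × F // p.1 ^ (q + 1) + ν * p.2 ^ (q + 1) = μ} ≃
      Σ b : F, {a : F // a ^ (q + 1) = μ - ν * b ^ (q + 1)} :=
    { toFun := fun p => ⟨p.1.2, p.1.1, eq_sub_of_add_eq p.2⟩
      invFun := fun p => ⟨(p.2.1, p.1), by rw [p.2.2, sub_add_cancel]⟩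
      left_inv := fun p => rfl
      right_inv := fun p => rfl }
  rw [Nat.card_congr e, Nat.card_sigma]
  have h1 : ∀ b ∈ B, Nat.card {a : F // a ^ (q + 1) = μ - ν * b ^ (q + 1)} ≤ 1 := by
    intro b hb
    have hb : b ^ (q + 1) = μ / ν := by simpa [B] using hb
    rw [hb, mul_div_cancel₀ _ hν0, sub_self]
    refine Finite.card_le_one_iff_subsingleton.2 ⟨fun x y => Subtype.ext ?_⟩
    rw [eq_zero_of_pow_eq_zero x.2, eq_zero_of_pow_eq_zero y.2]
  have h2 : ∀ b ∈ Bᶜ, Nat.card {a : F // a ^ (q + 1) = μ - ν * b ^ (q + 1)} ≤ q + 1 :=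
    fun b _ => card_pow_eq_le (Nat.succ_pos q) _
  have hsum := add_le_add (Finset.sum_le_card_nsmul _ _ _ h1) (Finset.sum_le_card_nsmul _ _ _ h2)
  rw [Finset.sum_add_sum_compl] at hsum
  refine hsum.trans ?_
  simp only [smul_eq_mul, mul_one]
  have hq : 1 ≤ q ^ 2 := by nlinarith
  zify [hq] at hB hBc ⊢
  have : (Bᶜ.card : ℤ) = q ^ 2 - B.card := by linarith
  rw [this]
  -- The bound |B| + (q + 1)(q² - |B|) decreases in |B| with slope -q, so |B| = q + 1 is the worst
  -- case.
  nlinarith [mul_nonneg (Nat.cast_nonneg (α := ℤ) q) (sub_nonneg.2 hB)]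

end Roots

/-! ### Upper bounds for the stabilizers of the representatives -/

section Stabilizers

/-- A diagonal matrix of determinant one is determined by its first entry. -/
theorem SL_eq_of_diag {F : Type*} [Field F] {A B : SL(2, F)} (hA : A 0 1 = 0 ∧ A 1 0 = 0) (hB : B 0 1 = 0 ∧ B 1 0 = 0)
    (h : A 0 0 = B 0 0) : A = B := by
  have dA := SL_det A
  have dB := SL_det B
  rw [hA.1, zero_mul, sub_zero] at dA
  rw [hB.1, zero_mul, sub_zero] at dB
  refine SL_ext h (hA.1.trans hB.1.symm) (hA.2.trans hB.2.symm)
    (mul_left_cancel₀ (left_ne_zero_of_mul_eq_one dA) ?_)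
  rw [dA, h, dB]

variable {F : Type*} [Field F] [Finite F] {q : ℕ}

/-- The matrices in `SL(2, q ^ 2)` that fix a point. -/
abbrev stab (hF : Nat.card F = q ^ 2) (P : PG3 F) : Type _ :=
  {A : SL(2, F) // toPGL hF A • P = P}

theorem exists_of_stab (hF : Nat.card F = q ^ 2) {v : Fin 4 → F} {hv : v ≠ 0}
    (A : stab hF (Projectivization.mk F v hv)) : ∃ c : F, c ≠ 0 ∧ act hF A.1 v = c • v :=
  (toPGL_smul_mk_eq_iff hF A.1 hv).1 A.2

/-- Off the quadric, invariance of `quadForm` forces c² = 1. -/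
theorem exists_sign_of_stab (hF : Nat.card F = q ^ 2) {v : Fin 4 → F}
    {hv : v ≠ 0} (hD : quadForm v ≠ 0) (A : stab hF (Projectivization.mk F v hv)) :
    ∃ c : F, (c = 1 ∨ c = -1) ∧ act hF A.1 v = c • v := by
  obtain ⟨c, -, h⟩ := exists_of_stab hF A
  refine ⟨c, sq_eq_one_iff.1 ?_, h⟩
  have := quadForm_act hF A.1 v
  rw [h, quadForm_smul] at this
  exact mul_right_cancel₀ hD (this.trans (one_mul _).symm)


theorem act_eqs (hF : Nat.card F = q ^ 2) {A : SL(2, F)} {v₀ v₁ v₂ v₃ k : F}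
    (h : act hF A ![v₀, v₁, v₂, v₃] = k • ![v₀, v₁, v₂, v₃]) :
    (frob hF (A 0 0) * (A 0 0 * v₀ + A 0 1 * v₁) + frob hF (A 0 1) * (A 0 0 * v₂ + A 0 1 * v₃) =
      k * v₀) ∧
    (frob hF (A 0 0) * (A 1 0 * v₀ + A 1 1 * v₁) + frob hF (A 0 1) * (A 1 0 * v₂ + A 1 1 * v₃) =
      k * v₁) ∧
    (frob hF (A 1 0) * (A 0 0 * v₀ + A 0 1 * v₁) + frob hF (A 1 1) * (A 0 0 * v₂ + A 0 1 * v₃) =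
      k * v₂) ∧
    (frob hF (A 1 0) * (A 1 0 * v₀ + A 1 1 * v₁) + frob hF (A 1 1) * (A 1 0 * v₂ + A 1 1 * v₃) =
      k * v₃) :=
  ⟨congrFun h 0, congrFun h 1, congrFun h 2, congrFun h 3⟩

theorem frob_sign (hF : Nat.card F = q ^ 2) {k : F} (hk : k = 1 ∨ k = -1) : frob hF k = k := by
  rcases hk with rfl | rfl <;> simp

theorem card_stab_e4_le (hF : Nat.card F = q ^ 2) (hv : (![0, 0, 0, 1] : Fin 4 → F) ≠ 0) :
    Nat.card (stab hF (Projectivization.mk F ![0, 0, 0, 1] hv)) ≤ (q ^ 2 - 1) * q ^ 2 := by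
  have key : ∀ A : stab hF (Projectivization.mk F ![0, 0, 0, 1] hv),
      A.1 0 1 = 0 ∧ A.1 0 0 * A.1 1 1 = 1 := by
    intro A
    obtain ⟨k, hk, h⟩ := exists_of_stab hF A
    obtain ⟨e0, -, -, -⟩ := act_eqs hF h
    have h01 : A.1 0 1 = 0 := by simpa [frob_eq_zero] using e0
    have := SL_det A.1
    rw [h01, zero_mul, sub_zero] at this
    exact ⟨h01, this⟩
  let f : stab hF (Projectivization.mk F ![0, 0, 0, 1] hv) → Fˣ × F := fun A =>
    (Units.mk0 (A.1 0 0) (left_ne_zero_of_mul_eq_one (key A).2), A.1 1 0)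
  have hf : Function.Injective f := by
    intro A B h
    simp only [f, Prod.mk.injEq, Units.mk0_inj] at h
    refine Subtype.ext (SL_ext h.1 ((key A).1.trans (key B).1.symm) h.2
      (mul_left_cancel₀ (left_ne_zero_of_mul_eq_one (key A).2) ?_))
    rw [(key A).2, h.1, (key B).2]
  refine (Nat.card_le_card_of_injective f hf).trans (le_of_eq ?_)
  rw [Nat.card_prod, Nat.card_units, hF]

theorem card_stab_U_le (hF : Nat.card F = q ^ 2) : Nat.card (stab hF (ptU F)) ≤ q ^ 2 - 1 := by
  have key : ∀ A : stab hF (ptU F), A.1 0 1 = 0 ∧ A.1 1 0 = 0 ∧ A.1 0 0 ≠ 0 := by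
    intro A
    obtain ⟨k, hk, h⟩ := exists_of_stab hF A
    obtain ⟨e0, e1, e2, e3⟩ := act_eqs hF h
    simp only [mul_zero, mul_one, zero_add, add_zero] at e0 e1 e2 e3
    have h1 : frob hF (A.1 0 0) ≠ 0 := left_ne_zero_of_mul (e1 ▸ hk)
    have h2 : A.1 1 1 ≠ 0 := right_ne_zero_of_mul (e1 ▸ hk)
    exact ⟨(mul_eq_zero.1 e0).resolve_left h1,
      (frob_eq_zero hF).1 ((mul_eq_zero.1 e3).resolve_right h2), fun h => h1 (by simp [h])⟩
  let f : stab hF (ptU F) → Fˣ := fun A => Units.mk0 (A.1 0 0) (key A).2.2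
  have hf : Function.Injective f := by
    intro A B h
    exact Subtype.ext (SL_eq_of_diag ⟨(key A).1, (key A).2.1⟩ ⟨(key B).1, (key B).2.1⟩
      ((Units.mk0_inj _ _).1 h))
  refine (Nat.card_le_card_of_injective f hf).trans (le_of_eq ?_)
  rw [Nat.card_units, hF]

/-- The stabilizer consists of diagonal matrices whose first entry has norm ±1. Norms are fixed by
σ, so subtracting an equation from its conjugate isolates one norm, multiplied by r^q - r ≠ 0. -/
theorem card_stab_secant_le (hF : Nat.card F = q ^ 2) {r : F} (hr : r ^ q ≠ r)
    (hv : (![r, 0, 0, 1] : Fin 4 → F) ≠ 0) :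
    Nat.card (stab hF (Projectivization.mk F ![r, 0, 0, 1] hv)) ≤ 2 * (q + 1) := by
  have hr0 : r ≠ 0 := by
    rintro rfl
    exact hr (zero_pow (ne_zero_of_card hF))
  have key : ∀ A : stab hF (Projectivization.mk F ![r, 0, 0, 1] hv),
      (A.1 0 1 = 0 ∧ A.1 1 0 = 0) ∧ A.1 0 0 ^ (2 * (q + 1)) = 1 := by
    intro A
    obtain ⟨k, hk, h⟩ := exists_sign_of_stab hF (by simpa [quadForm] using hr0) A
    obtain ⟨e0, e1, e2, e3⟩ := act_eqs hF h
    have hdet := SL_det A.1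
    have hkk := frob_sign hF hk
    have c0 := congrArg (frob hF) e0
    have c3 := congrArg (frob hF) e3
    simp only [map_add, map_mul, frob_frob, map_zero, map_one, hkk] at c0 c3
    have hr' : frob hF r - r ≠ 0 := sub_ne_zero.2 hr
    have ha : frob hF (A.1 0 0) * A.1 0 0 = k := by
      refine mul_right_cancel₀ hr' ?_
      linear_combination c0 - e0
    have hb : A.1 0 1 = 0 := by
      have : A.1 0 1 * frob hF (A.1 0 1) = 0 := by linear_combination e0 - r * ha
      simpa [frob_eq_zero] using this
    have hc : A.1 1 0 = 0 := by
      have : A.1 1 0 * frob hF (A.1 1 0) = 0 := by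
        refine mul_right_cancel₀ hr' ?_
        linear_combination c3 - e3
      simpa [frob_eq_zero] using this
    refine ⟨⟨hb, hc⟩, ?_⟩
    rw [mul_comm 2, pow_mul, pow_succ _ q, ← frob_apply hF, ha]
    exact sq_eq_one_iff.2 hk
  refine (Nat.card_le_card_of_injective (fun A => (⟨A.1 0 0, (key A).2⟩ :
    {x : F // x ^ (2 * (q + 1)) = 1})) ?_).trans (card_pow_eq_le (by omega) 1)
  intro A B h
  exact Subtype.ext (SL_eq_of_diag (key A).1 (key B).1 (congrArg Subtype.val h))

/-- The conjugate of one equation, times s, shares all but one product with another equation; the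
difference is that product times s^(q+1) - 1 ≠ 0. This kills the off-diagonal entries, and then a^q
d = ±1 with a d = 1 gives a^(q-1) = ±1. -/
theorem card_stab_external_le (hF : Nat.card F = q ^ 2) (hq : 1 < q) {s : F} (hs0 : s ≠ 0)
    (hs : s ^ (q + 1) ≠ 1) (hv : (![0, s, 1, 0] : Fin 4 → F) ≠ 0) :
    Nat.card (stab hF (Projectivization.mk F ![0, s, 1, 0] hv)) ≤ 2 * (q - 1) := by
  have hs' : frob hF s * s - 1 ≠ 0 := by
    rw [frob_apply, ← pow_succ]
    exact sub_ne_zero.2 hs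
  have key : ∀ A : stab hF (Projectivization.mk F ![0, s, 1, 0] hv),
      (A.1 0 1 = 0 ∧ A.1 1 0 = 0) ∧ A.1 0 0 ^ (2 * (q - 1)) = 1 := by
    intro A
    obtain ⟨k, hk, h⟩ := exists_sign_of_stab hF (by simpa [quadForm] using hs0) A
    obtain ⟨e0, e1, e2, e3⟩ := act_eqs hF h
    have hdet := SL_det A.1
    have hk0 : k ≠ 0 := by rcases hk with rfl | rfl <;> simp
    have hkk := frob_sign hF hk
    have c0 := congrArg (frob hF) e0
    have c2 := congrArg (frob hF) e2
    have c3 := congrArg (frob hF) e3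
    simp only [map_add, map_mul, frob_frob, map_zero, map_one, hkk] at c0 c2 c3
    have hbc : frob hF (A.1 0 1) * A.1 1 0 = 0 := by
      refine (mul_eq_zero.1 ?_).resolve_left hs'
      linear_combination s * c2 - e1
    have had : frob hF (A.1 0 0) * A.1 1 1 = k := by
      refine mul_right_cancel₀ hs0 ?_
      linear_combination e1 - hbc
    have ha0 : A.1 0 0 ≠ 0 := fun h => by
      rw [h, map_zero, zero_mul] at had
      exact hk0 had.symm
    have hd0 : A.1 1 1 ≠ 0 := right_ne_zero_of_mul (had ▸ hk0)
    have hb : A.1 0 1 = 0 := by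
      have : A.1 0 0 * frob hF (A.1 0 1) = 0 := by
        refine (mul_eq_zero.1 ?_).resolve_left hs'
        linear_combination s * c0 - e0
      simpa [frob_eq_zero, ha0] using this
    have hc : A.1 1 0 = 0 := by
      have : frob hF (A.1 1 1) * A.1 1 0 = 0 := by
        refine (mul_eq_zero.1 ?_).resolve_left hs'
        linear_combination s * c3 - e3
      simpa [frob_eq_zero, hd0] using this
    refine ⟨⟨hb, hc⟩, ?_⟩
    rw [hb, zero_mul, sub_zero] at hdet
    have : A.1 0 0 ^ (q - 1) = k := by
      refine mul_right_cancel₀ ha0 ?_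
      rw [← pow_succ, Nat.sub_add_cancel hq.le, ← frob_apply hF]
      linear_combination A.1 0 0 * had - frob hF (A.1 0 0) * hdet
    rw [mul_comm 2, pow_mul, this]
    exact sq_eq_one_iff.2 hk
  refine (Nat.card_le_card_of_injective (fun A => (⟨A.1 0 0, (key A).2⟩ :
    {x : F // x ^ (2 * (q - 1)) = 1})) ?_).trans (card_pow_eq_le (by omega) 1)
  intro A B h
  exact Subtype.ext (SL_eq_of_diag (key A).1 (key B).1 (congrArg Subtype.val h))

/-- As z has norm one, subtracting an equation from z times its conjugate leaves a norm times z x^q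
- x ≠ 0. So the matrix is upper triangular with equal diagonal entries ±1, and its corner b
satisfies b^q + z b = 0, which has at most q solutions. -/
theorem card_stab_tangent_le (hF : Nat.card F = q ^ 2) (hq : 1 < q) {x z : F}
    (hz : z ^ (q + 1) = 1) (hx : z * x ^ q ≠ x) (hv : (![x, z, 1, 0] : Fin 4 → F) ≠ 0) :
    Nat.card (stab hF (Projectivization.mk F ![x, z, 1, 0] hv)) ≤ 2 * q := by
  have hz1 : frob hF z * z = 1 := by rw [frob_apply, ← pow_succ, hz]
  have hz0 : z ≠ 0 := right_ne_zero_of_mul_eq_one hz1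
  have hx' : z * frob hF x - x ≠ 0 := sub_ne_zero.2 hx
  have key : ∀ A : stab hF (Projectivization.mk F ![x, z, 1, 0] hv),
      A.1 1 0 = 0 ∧ A.1 0 0 = A.1 1 1 ∧ A.1 0 0 ^ 2 = 1 ∧ A.1 0 1 ^ q + z * A.1 0 1 = 0 := by
    intro A
    obtain ⟨k, hk, h⟩ := exists_sign_of_stab hF (by simpa [quadForm] using hz0) A
    obtain ⟨e0, e1, e2, e3⟩ := act_eqs hF h
    have hdet := SL_det A.1
    have hk0 : k ≠ 0 := by rcases hk with rfl | rfl <;> simp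
    have hkk := frob_sign hF hk
    have c0 := congrArg (frob hF) e0
    have c3 := congrArg (frob hF) e3
    simp only [map_add, map_mul, frob_frob, map_zero, map_one, hkk] at c0 c3
    have hc : A.1 1 0 = 0 := by
      have : A.1 1 0 * frob hF (A.1 1 0) = 0 := by
        refine (mul_eq_zero.1 ?_).resolve_left hx'
        linear_combination z * c3 - e3 - frob hF (A.1 1 1) * A.1 1 0 * hz1
      simpa [frob_eq_zero] using this
    have haa : frob hF (A.1 0 0) * A.1 0 0 = k := by
      refine mul_right_cancel₀ hx' ?_
      linear_combination z * c0 - e0 - frob hF (A.1 0 1) * A.1 0 0 * hz1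
    rw [hc] at e1 hdet
    have had : frob hF (A.1 0 0) * A.1 1 1 = k := by
      refine mul_right_cancel₀ hz0 ?_
      linear_combination e1
    have ha' : frob hF (A.1 0 0) ≠ 0 := left_ne_zero_of_mul (had ▸ hk0)
    have had' : A.1 0 0 = A.1 1 1 := mul_left_cancel₀ ha' (haa.trans had.symm)
    have hsq : A.1 0 0 ^ 2 = 1 := by linear_combination hdet + A.1 0 0 * had'
    have hfa : frob hF (A.1 0 0) = A.1 0 0 := frob_sign hF (sq_eq_one_iff.1 hsq)
    refine ⟨hc, had', hsq, ?_⟩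
    have ha0 : A.1 0 0 ≠ 0 := hfa ▸ ha'
    rw [← frob_apply hF]
    refine mul_left_cancel₀ ha0 ?_
    linear_combination e0 - x * haa - z * A.1 0 1 * hfa
  let f : stab hF (Projectivization.mk F ![x, z, 1, 0] hv) →
      {a : F // a ^ 2 = 1} × {b : F // b ^ q + z * b = 0} := fun A =>
    (⟨A.1 0 0, (key A).2.2.1⟩, ⟨A.1 0 1, (key A).2.2.2⟩)
  have hf : Function.Injective f := by
    intro A B h
    simp only [f, Prod.mk.injEq, Subtype.mk.injEq] at h
    exact Subtype.ext (SL_ext h.1 h.2 ((key A).1.trans (key B).1.symm)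
      ((key A).2.1.symm.trans (h.1.trans (key B).2.1)))
  refine (Nat.card_le_card_of_injective f hf).trans ?_
  rw [Nat.card_prod]
  exact Nat.mul_le_mul (card_pow_eq_le two_pos 1) (card_pow_add_mul_eq_zero_le hq z)

/-- The stabilizer preserves the Hermitian form diag(1, ν) up to a sign k. The first row has form
value k, and it determines the second row together with k, so two norm counts suffice. -/
theorem card_stab_Sig_le (hF : Nat.card F = q ^ 2) {ν : F} (hν : ν ^ q = ν) (hν0 : ν ≠ 0)
    (hv : (![1, 0, 0, ν] : Fin 4 → F) ≠ 0) :
    Nat.card (stab hF (Projectivization.mk F ![1, 0, 0, ν] hv)) ≤ 2 * (q * (q ^ 2 - 1)) := by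
  classical
  have key : ∀ A : stab hF (Projectivization.mk F ![1, 0, 0, ν] hv), ∃ k : F,
      (k = 1 ∨ k = -1) ∧ A.1 1 1 = k * frob hF (A.1 0 0) ∧
        A.1 1 0 = - k * ν * frob hF (A.1 0 1) ∧
        A.1 0 0 ^ (q + 1) + ν * A.1 0 1 ^ (q + 1) = k := by
    intro A
    obtain ⟨k, hk, h⟩ := exists_sign_of_stab hF (by simpa [quadForm] using hν0) A
    obtain ⟨e0, e1, e2, e3⟩ := act_eqs hF h
    have hdet := SL_det A.1
    have hk2 : k * k = 1 := by rcases hk with rfl | rfl <;> simp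
    have hkk := frob_sign hF hk
    -- Cramer's rule: `e0` and `e1` are linear in σ(a) and ν σ(b) with determinant 1; multiplying by
    -- k and using k² = 1 solves for the second row.
    have hd : A.1 1 1 = k * frob hF (A.1 0 0) := by
      linear_combination (-A.1 1 1 * hk2) + k * frob hF (A.1 0 0) * hdet - k * A.1 1 1 * e0 +
        k * A.1 0 1 * e1
    have hc : A.1 1 0 = - k * ν * frob hF (A.1 0 1) := by
      linear_combination (-A.1 1 0 * hk2) - k * ν * frob hF (A.1 0 1) * hdet -
        k * A.1 1 0 * e0 + k * A.1 0 0 * e1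
    refine ⟨k, hk, hd, hc, ?_⟩
    rw [pow_succ, pow_succ, ← frob_apply hF, ← frob_apply hF]
    linear_combination e0
  choose k hk hd hc hN using key
  let f : stab hF (Projectivization.mk F ![1, 0, 0, ν] hv) →
      {p : F × F // p.1 ^ (q + 1) + ν * p.2 ^ (q + 1) = 1} ⊕
        {p : F × F // p.1 ^ (q + 1) + ν * p.2 ^ (q + 1) = -1} := fun A =>
    if h : k A = 1 then Sum.inl ⟨(A.1 0 0, A.1 0 1), (hN A).trans h⟩
    else Sum.inr ⟨(A.1 0 0, A.1 0 1), (hN A).trans ((hk A).resolve_left h)⟩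
  have hf : Function.Injective f := by
    intro A B h
    have hkAB : k A = k B ∧ A.1 0 0 = B.1 0 0 ∧ A.1 0 1 = B.1 0 1 := by
      by_cases hA : k A = 1 <;> by_cases hB : k B = 1 <;> simp [f, hA, hB] at h
      · exact ⟨hA.trans hB.symm, h.1, h.2⟩
      · exact ⟨((hk A).resolve_left hA).trans ((hk B).resolve_left hB).symm, h.1, h.2⟩
    obtain ⟨h1, h2, h3⟩ := hkAB
    refine Subtype.ext (SL_ext h2 h3 ?_ ?_)
    · rw [hc A, hc B, h1, h3]
    · rw [hd A, hd B, h1, h2]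
  refine (Nat.card_le_card_of_injective f hf).trans ?_
  rw [Nat.card_sum, two_mul]
  refine add_le_add (card_norm_add_norm_eq_le hF hν hν0 (one_pow _) one_ne_zero)
    (card_norm_add_norm_eq_le hF hν hν0 ?_ (neg_ne_zero.2 one_ne_zero))
  rw [← frob_apply hF, map_neg, map_one]

end Stabilizers

/-! ### Orbit counting and group orders -/

section Counting

/-- Orbit-stabilizer for the action pulled back along `f`: stabilizers are counted upstairs, so the
kernel of `f` plays no role. -/
theorem card_eq_ncard_orbit_range_mul {G H X : Type*} [Group G] [Finite G] [Group H]
    [MulAction H X] (f : G →* H) (x : X) :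
    Nat.card G = (orbit f.range x).ncard * Nat.card {g : G // f g • x = x} := by
  let _ := MulAction.compHom X f
  have h1 : orbit f.range x = orbit G x := by
    ext y
    constructor
    · rintro ⟨⟨_, g, rfl⟩, h⟩
      exact ⟨g, h⟩
    · rintro ⟨g, h⟩
      exact ⟨⟨_, g, rfl⟩, h⟩
  rw [h1, ← Nat.card_congr (orbitProdStabilizerEquivGroup G x), Nat.card_prod,
    Nat.card_coe_set_eq]
  rfl

/-- Disjoint orbits with at least `n i` elements fit into `X`, whose size is at most the sum of the
`n i`; hence equality holds throughout and the orbits cover `X`. -/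
theorem orbits_of_card {G X ι : Type*} [Group G] [MulAction G X] [Finite X] [Fintype ι]
    (rep : ι → X) (n : ι → ℕ) (hinj : ∀ i j, rep j ∈ orbit G (rep i) → i = j)
    (hn : ∀ i, n i ≤ (orbit G (rep i)).ncard) (hsum : Nat.card X ≤ ∑ i, n i) :
    (∀ i, (orbit G (rep i)).ncard = n i) ∧ ∀ x, ∃ i, x ∈ orbit G (rep i) := by
  let e : (Σ i, orbit G (rep i)) → X := fun p => p.2
  have he : Function.Injective e := by
    rintro ⟨i, x, hx⟩ ⟨j, y, hy⟩ (rfl : x = y)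
    obtain rfl : i = j := by
      refine hinj i j ?_
      rw [← orbit_eq_iff, ← orbit_eq_iff.2 hx, orbit_eq_iff.2 hy]
    rfl
  have hle := Nat.card_le_card_of_injective e he
  have hcard : Nat.card (Σ i, orbit G (rep i)) = ∑ i, (orbit G (rep i)).ncard := by
    rw [Nat.card_sigma]
    simp only [Nat.card_coe_set_eq]
  rw [hcard] at hle
  have hsum' := Finset.sum_le_sum fun i (_ : i ∈ Finset.univ) => hn i
  constructor
  · intro i
    have := (Finset.sum_eq_sum_iff_of_le fun i (_ : i ∈ Finset.univ) => hn i).1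
      (hsum'.antisymm (hle.trans hsum))
    exact (this i (Finset.mem_univ i)).symm
  · have hbij : Function.Bijective e := (Nat.bijective_iff_injective_and_card e).2
      ⟨he, (hcard.trans_le hle).antisymm
        ((hsum.trans hsum').trans hcard.ge)⟩
    intro x
    obtain ⟨⟨i, y⟩, rfl⟩ := hbij.2 x
    exact ⟨i, y.2⟩

/-- The kernel of the determinant has index Q - 1 in GL(2, Q) and embeds in SL(2, Q). A lower bound
is all that the squeeze needs. -/
theorem card_SL_two_ge {F : Type*} [Field F] [Finite F] {Q : ℕ} (hF : Nat.card F = Q) :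
    Q * (Q ^ 2 - 1) ≤ Nat.card SL(2, F) := by
  cases nonempty_fintype F
  have hQ : 1 < Q := hF ▸ Finite.one_lt_card
  have h1 := Matrix.card_GL_field (𝔽 := F) 2
  rw [Fin.prod_univ_two, ← Nat.card_eq_fintype_card, hF] at h1
  let d : GL (Fin 2) F →* Fˣ := Matrix.GeneralLinearGroup.det
  have h2 : Nat.card d.ker * Nat.card Fˣ = Nat.card (GL (Fin 2) F) := by
    rw [← d.ker.card_mul_index, Subgroup.index_ker,
      MonoidHom.range_eq_top.2 Matrix.GeneralLinearGroup.det_surjective, Subgroup.card_top]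
  have h3 : Nat.card d.ker ≤ Nat.card SL(2, F) := by
    refine Nat.card_le_card_of_injective
      (fun g => (⟨(g.1 : Matrix (Fin 2) (Fin 2) F), ?_⟩ : SL(2, F))) ?_
    · exact congrArg Units.val g.2
    · intro g g' h
      exact Subtype.ext (Units.ext (congrArg Subtype.val h))
  rw [Nat.card_units, hF, h1] at h2
  refine le_trans (le_of_eq ?_) h3
  refine Nat.eq_of_mul_eq_mul_right (Nat.sub_pos_of_lt hQ) (Eq.trans ?_ h2.symm)
  obtain ⟨r, rfl⟩ : ∃ r, Q = r + 1 := ⟨Q - 1, by omega⟩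
  have e1 : (r + 1) ^ 2 - 1 = r * (r + 2) := by
    rw [show (r + 1) ^ 2 = r * (r + 2) + 1 by ring, Nat.add_sub_cancel]
  have e2 : (r + 1) ^ 2 - (r + 1) = r * (r + 1) := by
    rw [show (r + 1) ^ 2 = r * (r + 1) + (r + 1) by ring, Nat.add_sub_cancel]
  simp only [Fin.val_zero, Fin.val_one, pow_zero, pow_one, e1, e2, Nat.add_sub_cancel]
  ring

theorem card_PG3 {F : Type*} [Field F] [Finite F] {q : ℕ} (hF : Nat.card F = q ^ 2) :
    Nat.card (PG3 F) = (q ^ 2 + 1) * (q ^ 4 + 1) := by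
  rw [Projectivization.card_of_finrank F (Fin 4 → F) (n := 4) (by simp), hF]
  simp only [Finset.sum_range_succ, Finset.sum_range_zero]
  ring

end Counting

/-! ### The isomorphism of K with PSL(2, q²) -/

section KernelOfTwist

variable {F : Type*} [Field F] [Finite F] {q : ℕ}

/-- If `A ^ q ⊗ A` is scalar, its corners kill the off-diagonal entries of A and a^q a = a^q d gives
a = d. Conversely a scalar r with r² = 1 has r^(q+1) = 1 because q is odd. -/
theorem ker_toPGL (hF : Nat.card F = q ^ 2) (hq : Odd q) :
    (toPGL hF).ker = Subgroup.center SL(2, F) := by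
  ext A
  rw [Matrix.SpecialLinearGroup.mem_center_iff, MonoidHom.mem_ker, toPGL, MonoidHom.comp_apply,
    Matrix.ProjGenLinGroup.mk_eq_one, Matrix.GeneralLinearGroup.center_eq_range_scalar]
  constructor
  · rintro ⟨u, hu⟩
    have hu := (congrArg Units.val hu).symm.trans
      (Matrix.GeneralLinearGroup.coe_scalar u)
    rw [twist_coe] at hu
    have h03 := congrFun (congrFun hu 0) 3
    have h30 := congrFun (congrFun hu 3) 0
    have h00 := congrFun (congrFun hu 0) 0
    have h11 := congrFun (congrFun hu 1) 1
    simp [ne_zero_of_card hF] at h00 h03 h11 h30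
    have hdet := SL_det A
    rw [h03, zero_mul, sub_zero] at hdet
    have ha : A 0 0 ≠ 0 := left_ne_zero_of_mul_eq_one hdet
    have had : A 0 0 = A 1 1 := mul_left_cancel₀ (pow_ne_zero q ha) (h00.trans h11.symm)
    refine ⟨A 0 0, ?_, ?_⟩
    · rw [Fintype.card_fin, sq]
      rwa [← had] at hdet
    · ext i j
      fin_cases i <;> fin_cases j <;> simp [h03, h30, had]
  · rintro ⟨r, hr, hA⟩
    refine ⟨1, ?_⟩
    have h : ∀ i j, A i j = Matrix.scalar (Fin 2) r i j := fun i j => by rw [hA]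
    have hrq : r ^ q * r = 1 := by
      obtain ⟨m, rfl⟩ := hq
      rw [← pow_succ, show 2 * m + 1 + 1 = 2 * (m + 1) by ring, pow_mul]
      rw [Fintype.card_fin] at hr
      rw [hr, one_pow]
    rw [map_one]
    ext i j
    rw [twist_coe]
    fin_cases i <;> fin_cases j <;> simp [h, hrq, ne_zero_of_card hF]

theorem nonempty_K_mulEquiv (hF : Nat.card F = q ^ 2) (hq : Odd q) :
    Nonempty (K hF ≃* PSL(2, F)) :=
  ⟨((QuotientGroup.quotientMulEquivOfEq (ker_toPGL hF hq).symm).trans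
    (QuotientGroup.quotientKerEquivRange (toPGL hF))).symm⟩

end KernelOfTwist

/-! ### Powers of the primitive element and the parameters γ -/

section Generator

variable {F : Type*} [Field F] {q : ℕ}

theorem pow_eq_pow_iff_of_generator (hF : Nat.card F = q ^ 2) {ξ : Fˣ}
    (hξ : ∀ x : Fˣ, x ∈ Subgroup.zpowers ξ) (i j : ℕ) :
    (ξ : F) ^ i = (ξ : F) ^ j ↔ i ≡ j [MOD q ^ 2 - 1] := by
  have hord : orderOf ξ = q ^ 2 - 1 := by
    rw [orderOf_eq_card_of_forall_mem_zpowers hξ, Nat.card_units, hF]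
  rw [← hord, ← pow_eq_pow_iff_modEq, ← Units.val_inj, Units.val_pow_eq_pow_val,
    Units.val_pow_eq_pow_val]

theorem pow_eq_one_iff_of_generator (hF : Nat.card F = q ^ 2) {ξ : Fˣ}
    (hξ : ∀ x : Fˣ, x ∈ Subgroup.zpowers ξ) (i : ℕ) :
    (ξ : F) ^ i = 1 ↔ q ^ 2 - 1 ∣ i := by
  rw [← pow_zero (ξ : F), pow_eq_pow_iff_of_generator hF hξ, Nat.modEq_zero_iff_dvd]

theorem pow_half_of_generator (hF : Nat.card F = q ^ 2) {ξ : Fˣ}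
    (hξ : ∀ x : Fˣ, x ∈ Subgroup.zpowers ξ) {h : ℕ} (hh : q ^ 2 - 1 = 2 * h) (h0 : 0 < h) :
    (ξ : F) ^ h = -1 := by
  have h2 : ((ξ : F) ^ h) ^ 2 = 1 := by
    rw [← pow_mul, pow_eq_one_iff_of_generator hF hξ, hh, mul_comm]
  refine (sq_eq_one_iff.1 h2).resolve_left fun h1 => ?_
  rw [pow_eq_one_iff_of_generator hF hξ, hh] at h1
  have := Nat.le_of_dvd h0 h1
  omega

theorem isSquare_pow_iff_of_generator [Finite F] (hF : Nat.card F = q ^ 2) (hq : Odd q) {ξ : Fˣ}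
    (hξ : ∀ x : Fˣ, x ∈ Subgroup.zpowers ξ) (i : ℕ) :
    IsSquare ((ξ : F) ^ i) ↔ Even i := by
  constructor
  · rintro ⟨y, hy⟩
    have hy0 : y ≠ 0 := by
      rintro rfl
      rw [mul_zero] at hy
      exact pow_ne_zero _ ξ.ne_zero hy
    obtain ⟨k, hk⟩ := mem_powers_iff_mem_zpowers.2 (hξ (Units.mk0 y hy0))
    have hk : (ξ : F) ^ k = y := by
      rw [← Units.val_pow_eq_pow_val]
      exact congrArg Units.val hk
    rw [← hk, ← pow_add, pow_eq_pow_iff_of_generator hF hξ] at hy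
    have h2 : 2 ∣ q ^ 2 - 1 := by
      obtain ⟨m, rfl⟩ := hq
      exact ⟨2 * m * (m + 1), by rw [show (2 * m + 1) ^ 2 = 2 * (2 * m * (m + 1)) + 1 by ring,
        Nat.add_sub_cancel]⟩
    have := hy.of_dvd h2
    rw [Nat.even_iff, this, ← two_mul, Nat.mul_mod_right]
  · exact fun h => h.isSquare_pow _

theorem add_inv_inj {x y : F} (hx : x ≠ 0) (hy : y ≠ 0) :
    x + x⁻¹ = y + y⁻¹ ↔ x = y ∨ x * y = 1 := by
  have : x + x⁻¹ = y + y⁻¹ ↔ (x - y) * (x * y - 1) = 0 := by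
    field_simp
    rw [← sub_eq_zero]
    ring_nf
  rw [this, mul_eq_zero, sub_eq_zero, sub_eq_zero]

theorem mk_mem_surface_iff (hq : Odd q) {γ t : F} {v : Fin 4 → F} (hv : v ≠ 0)
    (hD : quadForm v ≠ 0) (h : hermForm q v = t * quadForm v ^ ((q + 1) / 2)) :
    Projectivization.mk F v hv ∈ surface q γ ↔ γ = t := by
  rw [mk_mem_surface hq, h, mul_left_inj' (pow_ne_zero _ hD), eq_comm]

/-- The values `ξ ^ e + ξ ^ (-e)`. -/
def trPow (ξ : Fˣ) (e : ℕ) : F := (ξ : F) ^ e + ((ξ : F) ^ e)⁻¹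

/-- The trace determines the pair {ξ^e, ξ^(-e)}, and exponents up to half the order of ξ represent
each such pair once. -/
theorem trPow_inj (hF : Nat.card F = q ^ 2) {ξ : Fˣ}
    (hξ : ∀ x : Fˣ, x ∈ Subgroup.zpowers ξ) {h : ℕ} (hh : q ^ 2 - 1 = 2 * h) {e f : ℕ}
    (he : e ≤ h) (hf : f ≤ h) : trPow ξ e = trPow ξ f ↔ e = f := by
  refine ⟨fun H => ?_, fun H => H ▸ rfl⟩
  rcases (add_inv_inj (pow_ne_zero _ ξ.ne_zero) (pow_ne_zero _ ξ.ne_zero)).1 H with H | H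
  · rw [pow_eq_pow_iff_of_generator hF hξ, hh] at H
    rcases Nat.eq_zero_or_pos h with h0 | h0
    · omega
    · exact Nat.ModEq.eq_of_lt_of_lt H (by omega) (by omega)
  · rw [← pow_add, pow_eq_one_iff_of_generator hF hξ, hh] at H
    rcases Nat.eq_zero_or_pos (e + f) with h0 | h0
    · omega
    · have := Nat.le_of_dvd h0 H
      omega

theorem trPow_sub (hF : Nat.card F = q ^ 2) {ξ : Fˣ}
    (hξ : ∀ x : Fˣ, x ∈ Subgroup.zpowers ξ) {h : ℕ} (hh : q ^ 2 - 1 = 2 * h) (h0 : 0 < h) {e : ℕ}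
    (he : e ≤ h) : trPow ξ (h - e) = -trPow ξ e := by
  have : (ξ : F) ^ (h - e) = -((ξ : F) ^ e)⁻¹ := by
    refine mul_right_cancel₀ (pow_ne_zero e ξ.ne_zero) ?_
    rw [← pow_add, Nat.sub_add_cancel he, pow_half_of_generator hF hξ hh h0, neg_mul,
      inv_mul_cancel₀ (pow_ne_zero e ξ.ne_zero)]
  rw [trPow, trPow, this, inv_neg, inv_inv]
  ring

theorem trPow_zero (ξ : Fˣ) : trPow ξ 0 = 2 := by
  simp [trPow, one_add_one_eq_two]

end Generator

/-! ### The surface through each representative -/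

section Table

variable {F : Type*} [Field F]

/-- The index set of the orbits. -/
abbrev Idx (q : ℕ) : Type := Fin 6 ⊕ Fin q ⊕ Fin (q - 2)

/-- The correspondence between the indices of the points `Q_k` and of the surfaces `E_k`. -/
def twistIndex (q k : ℕ) : ℕ := if q % 4 = 1 then k else q - 1 - k

/-- The representatives of the orbits. -/
def rep (q : ℕ) (ξ : Fˣ) : Idx q → PG3 F
  | .inl i => ![Projectivization.mk F ![0, 0, 0, 1] (by simp), ptS1 F, ptS2 q ξ, ptU F,
      if q % 4 = 1 then ptT1 ξ else ptT2 q ξ, if q % 4 = 1 then ptT2 q ξ else ptT1 ξ] i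
  | .inr (.inl j) => ptR ξ (j + 1)
  | .inr (.inr k) => ptQ ξ (twistIndex q (k + 1))

/-- The exponent `e` for which the representative lies on the surface with parameter
`ξ ^ e + ξ ^ (-e)`. -/
def code (q : ℕ) : Idx q → ℕ
  | .inl i => ![0, 0, (q ^ 2 - 1) / 2, 0, 0, (q ^ 2 - 1) / 2] i
  | .inr (.inl j) => (j + 1) * ((q - 1) / 2)
  | .inr (.inr k) => (k + 1) * ((q + 1) / 2)


variable {q : ℕ}

theorem ptS1_mem_surface (hq : Odd q) {γ : F} : ptS1 F ∈ surface q γ ↔ γ = 2 := by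
  rw [ptS1, mk_mem_surface_iff hq]
  · simp [quadForm]
  · simp [quadForm, hermForm, one_add_one_eq_two]

variable [Finite F]

theorem one_lt_of_card (hF : Nat.card F = q ^ 2) : 1 < q := by
  have := Finite.one_lt_card (α := F)
  rw [hF] at this
  by_contra h
  interval_cases q <;> simp_all

theorem exists_half (hF : Nat.card F = q ^ 2) (hq : Odd q) :
    ∃ n, 0 < n ∧ q = 2 * n + 1 ∧ q ^ 2 - 1 = 2 * (2 * n * (n + 1)) := by
  obtain ⟨n, rfl⟩ := hq
  have := one_lt_of_card hF
  refine ⟨n, by omega, rfl, ?_⟩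
  rw [show (2 * n + 1) ^ 2 = 2 * (2 * n * (n + 1)) + 1 by ring, Nat.add_sub_cancel]

theorem pow_card_of_dvd (hF : Nat.card F = q ^ 2) (hq : Odd q) {ξ : Fˣ}
    (hξ : ∀ x : Fˣ, x ∈ Subgroup.zpowers ξ) (i : ℕ) :
    ((ξ : F) ^ i) ^ q = (ξ : F) ^ i ↔ q + 1 ∣ i := by
  obtain ⟨n, h0, rfl, hh⟩ := exists_half hF hq
  have hne := pow_ne_zero i ξ.ne_zero
  rw [pow_succ, mul_eq_right₀ hne, ← pow_mul, pow_eq_one_iff_of_generator hF hξ, hh,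
    show 2 * (2 * n * (n + 1)) = (2 * n + 1 + 1) * (2 * n) by ring,
    Nat.mul_dvd_mul_iff_right (by omega)]

/-- ξ^(q+1) generates the multiplicative group of the subfield, so it is a nonsquare there; this
makes the parameter -2 instead of 2. -/
theorem ptS2_mem_surface (hF : Nat.card F = q ^ 2) (hq : Odd q) {ξ : Fˣ}
    (hξ : ∀ x : Fˣ, x ∈ Subgroup.zpowers ξ) {γ : F} : ptS2 q ξ ∈ surface q γ ↔ γ = -2 := by
  obtain ⟨n, h0, rfl, hh⟩ := exists_half hF hq
  have h1 := (pow_card_of_dvd hF hq hξ (2 * n + 1 + 1)).2 dvd_rfl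
  have h2 : ((ξ : F) ^ (2 * n + 1 + 1)) ^ (n + 1) = -(ξ : F) ^ (2 * n + 1 + 1) := by
    rw [← pow_mul, show (2 * n + 1 + 1) * (n + 1) = 2 * n * (n + 1) + (2 * n + 1 + 1) by ring,
      pow_add, pow_half_of_generator hF hξ hh (by positivity), neg_one_mul]
  rw [ptS2, mk_mem_surface_iff hq]
  · simp [quadForm]
  · rw [show (2 * n + 1 + 1) / 2 = n + 1 by omega]
    simp [quadForm, hermForm, h1, h2]
    ring

theorem ptR_mem_surface (hF : Nat.card F = q ^ 2) (hq : Odd q) (ξ : Fˣ) (j : ℕ) {γ : F} :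
    ptR ξ j ∈ surface q γ ↔ γ = trPow ξ (j * ((q - 1) / 2)) := by
  obtain ⟨n, h0, rfl, hh⟩ := exists_half hF hq
  rw [ptR, mk_mem_surface_iff hq]
  · simp [quadForm]
  · rw [show (2 * n + 1 + 1) / 2 = n + 1 by omega, show (2 * n + 1 - 1) / 2 = n by omega]
    simp only [quadForm, hermForm, Matrix.cons_val, trPow, pow_mul]
    have := pow_ne_zero j ξ.ne_zero
    field_simp
    ring

/-- Here `quadForm` is -ξ^k and `hermForm` is negative as well, so the sign (-1)^((q-1)/2) survives.
It is the source of the dependence on q mod 4. -/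
theorem ptQ_mem_surface (hF : Nat.card F = q ^ 2) (hq : Odd q) (ξ : Fˣ) (k : ℕ) {γ : F} :
    ptQ ξ k ∈ surface q γ ↔ γ = (-1) ^ ((q - 1) / 2) * trPow ξ (k * ((q + 1) / 2)) := by
  obtain ⟨n, h0, rfl, hh⟩ := exists_half hF hq
  rw [ptQ, mk_mem_surface_iff hq]
  · simp [quadForm]
  · rw [show (2 * n + 1 + 1) / 2 = n + 1 by omega, show (2 * n + 1 - 1) / 2 = n by omega]
    have h1 : ((-1 : F) ^ n) * (-1) ^ n = 1 := by
      rw [← mul_pow, neg_one_mul, neg_neg, one_pow]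
    simp only [quadForm, hermForm, Matrix.cons_val, trPow, pow_mul]
    have := pow_ne_zero k ξ.ne_zero
    rw [show (0 : F) * 0 - (ξ : F) ^ k * 1 = -1 * (ξ : F) ^ k by ring, mul_pow (-1), pow_succ (-1)]
    field_simp
    linear_combination (((ξ : F) ^ k) ^ (2 * (n + 1)) + 1) * h1

/-- When q ≡ 3 mod 4 the sign is absorbed by replacing k with q - 1 - k, which negates the trace
because ξ^((q²-1)/2) = -1. -/
theorem twistIndex_mem_surface (hF : Nat.card F = q ^ 2) (hq : Odd q) {ξ : Fˣ}
    (hξ : ∀ x : Fˣ, x ∈ Subgroup.zpowers ξ) {k : ℕ} (hk : k ≤ q - 1) {γ : F} :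
    ptQ ξ (twistIndex q k) ∈ surface q γ ↔ γ = trPow ξ (k * ((q + 1) / 2)) := by
  rw [ptQ_mem_surface hF hq]
  obtain ⟨n, h0, rfl, hh⟩ := exists_half hF hq
  rw [show (2 * n + 1 + 1) / 2 = n + 1 by omega, show (2 * n + 1 - 1) / 2 = n by omega,
    twistIndex]
  split_ifs with h4
  · rw [Even.neg_one_pow (by rw [Nat.even_iff]; omega), one_mul]
  · rw [Odd.neg_one_pow (by rw [Nat.odd_iff]; omega), show 2 * n + 1 - 1 = 2 * n by omega,
      Nat.sub_mul, trPow_sub hF hξ hh (by positivity) (Nat.mul_le_mul_right _ (by omega)),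
      neg_one_mul, neg_neg]

theorem ptT1_mem_surface (hF : Nat.card F = q ^ 2) (hq : Odd q) (ξ : Fˣ) {γ : F} :
    ptT1 ξ ∈ surface q γ ↔ γ = (-1) ^ ((q - 1) / 2) * 2 := by
  obtain ⟨n, h0, rfl, hh⟩ := exists_half hF hq
  rw [ptT1, mk_mem_surface_iff hq]
  · simp [quadForm]
  · rw [show (2 * n + 1 + 1) / 2 = n + 1 by omega, show (2 * n + 1 - 1) / 2 = n by omega]
    have h1 : ((-1 : F) ^ n) * (-1) ^ n = 1 := by
      rw [← mul_pow, neg_one_mul, neg_neg, one_pow]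
    simp [quadForm, hermForm, pow_succ]
    linear_combination 2 * h1

theorem pow_sub_one_norm (hF : Nat.card F = q ^ 2) (hq : Odd q) {ξ : Fˣ}
    (hξ : ∀ x : Fˣ, x ∈ Subgroup.zpowers ξ) : ((ξ : F) ^ (q - 1)) ^ (q + 1) = 1 := by
  obtain ⟨n, h0, rfl, hh⟩ := exists_half hF hq
  rw [← pow_mul, pow_eq_one_iff_of_generator hF hξ, hh, show 2 * n + 1 - 1 = 2 * n by omega]
  exact dvd_of_eq (by ring)

theorem ptT2_mem_surface (hF : Nat.card F = q ^ 2) (hq : Odd q) {ξ : Fˣ}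
    (hξ : ∀ x : Fˣ, x ∈ Subgroup.zpowers ξ) {γ : F} :
    ptT2 q ξ ∈ surface q γ ↔ γ = -((-1) ^ ((q - 1) / 2) * 2) := by
  have hz := pow_sub_one_norm hF hq hξ
  obtain ⟨n, h0, rfl, hh⟩ := exists_half hF hq
  rw [ptT2, mk_mem_surface_iff hq]
  · simp [quadForm]
  · have h1 : ((-1 : F) ^ n) * (-1) ^ n = 1 := by
      rw [← mul_pow, neg_one_mul, neg_neg, one_pow]
    have h2 : ((ξ : F) ^ (2 * n + 1 - 1)) ^ (n + 1) = -1 := by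
      rw [← pow_mul, ← pow_half_of_generator hF hξ hh (by positivity),
        show 2 * n + 1 - 1 = 2 * n by omega]
    rw [show (2 * n + 1 + 1) / 2 = n + 1 by omega, show (2 * n + 1 - 1) / 2 = n by omega]
    generalize (ξ : F) ^ (2 * n + 1 - 1) = z at hz h2
    simp only [quadForm, hermForm, Matrix.cons_val, hz]
    rw [show z * 0 - z * 1 = -1 * z by ring, mul_pow, h2, pow_succ (-1)]
    simp
    linear_combination 2 * h1

end Table
-- Invariants of the representatives and their separation
section Membership

variable {F : Type*} [Field F] {q : ℕ}

theorem rep_mem_quadric (ξ : Fˣ) (i : Idx q) :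
    rep q ξ i ∈ quadric F ↔ i = .inl 0 ∨ i = .inl 3 := by
  rcases i with i | j | k
  · fin_cases i <;>
      simp [rep, ptS1, ptS2, ptU, ptT1, ptT2, mk_mem_quadric, quadForm]
    all_goals split_ifs <;> simp [mk_mem_quadric, quadForm]
  · simp [rep, ptR, mk_mem_quadric, quadForm]
  · simp [rep, ptQ, mk_mem_quadric, quadForm]

theorem e4_mem_surface (hq : Odd q) (γ : F) (hv : (![0, 0, 0, 1] : Fin 4 → F) ≠ 0) :
    Projectivization.mk F ![0, 0, 0, 1] hv ∈ surface q γ := by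
  have hq0 := hq.pos.ne'
  rw [mk_mem_surface hq]
  have : (q + 1) / 2 ≠ 0 := by omega
  simp [hermForm, quadForm, hq0, this]

theorem ptU_notMem_surface (hq : Odd q) (γ : F) : ptU F ∉ surface q γ := by
  have hq0 := hq.pos.ne'
  rw [ptU, mk_mem_surface hq]
  have : (q + 1) / 2 ≠ 0 := by omega
  simp [hermForm, quadForm, hq0, this]

theorem pow_norm_eq_one_iff (hF : Nat.card F = q ^ 2) {ξ : Fˣ}
    (hξ : ∀ x : Fˣ, x ∈ Subgroup.zpowers ξ) (k : ℕ) :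
    ((ξ : F) ^ k) ^ (q + 1) = 1 ↔ q - 1 ∣ k := by
  rw [← pow_mul, pow_eq_one_iff_of_generator hF hξ, show q ^ 2 - 1 = (q + 1) * (q - 1) by
    simpa using Nat.sq_sub_sq q 1, mul_comm k,
    Nat.mul_dvd_mul_iff_left (Nat.succ_pos q)]

variable [Finite F]

theorem ptT1_notMem_Sig (hF : Nat.card F = q ^ 2) (hq : Odd q) {ξ : Fˣ}
    (hξ : ∀ x : Fˣ, x ∈ Subgroup.zpowers ξ) : ptT1 ξ ∉ Sig F q := by
  intro h
  obtain ⟨c, h0, h1, -, -⟩ := exists_of_mk_mem_Sig hF h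
  obtain rfl : c = 1 := by simpa using h1.symm
  have := (pow_card_of_dvd hF hq hξ 1).1 (by simpa using h0)
  have := Nat.le_of_dvd one_pos this
  have := one_lt_of_card hF
  omega

theorem ptT2_norm_ne (hF : Nat.card F = q ^ 2) {ξ : Fˣ}
    (hξ : ∀ x : Fˣ, x ∈ Subgroup.zpowers ξ) : (ξ : F) ^ (q - 1) ≠ 1 := by
  have := one_lt_of_card hF
  rw [Ne, pow_eq_one_iff_of_generator hF hξ]
  intro h
  have := Nat.le_of_dvd (by omega) h
  have : 2 * q ≤ q ^ 2 := by nlinarith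
  omega

theorem ptT2_notMem_Sig (hF : Nat.card F = q ^ 2) {ξ : Fˣ}
    (hξ : ∀ x : Fˣ, x ∈ Subgroup.zpowers ξ) : ptT2 q ξ ∉ Sig F q := by
  intro h
  obtain ⟨c, h0, h1, -, -⟩ := exists_of_mk_mem_Sig hF h
  refine ptT2_norm_ne hF hξ ?_
  have h0 : ((ξ : F) ^ (q - 1)) ^ q = c * (ξ : F) ^ (q - 1) := h0
  have h1 : ((ξ : F) ^ (q - 1)) ^ q = c * 1 := h1
  have hc : c ≠ 0 := by
    rintro rfl
    simp at h1
  exact mul_left_cancel₀ hc (h0.symm.trans h1)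

theorem ptR_notMem_Sig (hF : Nat.card F = q ^ 2) (hq : Odd q) {ξ : Fˣ}
    (hξ : ∀ x : Fˣ, x ∈ Subgroup.zpowers ξ) {j : ℕ} (hj : ¬ q + 1 ∣ j) :
    ptR ξ j ∉ Sig F q := by
  intro h
  obtain ⟨c, h0, -, -, h3⟩ := exists_of_mk_mem_Sig hF h
  obtain rfl : c = 1 := by simpa using h3.symm
  exact hj ((pow_card_of_dvd hF hq hξ j).1 (by simpa using h0))

theorem ptQ_notMem_Sig (hF : Nat.card F = q ^ 2) {ξ : Fˣ}
    (hξ : ∀ x : Fˣ, x ∈ Subgroup.zpowers ξ) {k : ℕ} (hk : ¬ q - 1 ∣ k) :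
    ptQ ξ k ∉ Sig F q := by
  intro h
  obtain ⟨c, -, h1, h2, -⟩ := exists_of_mk_mem_Sig hF h
  have h1 : ((ξ : F) ^ k) ^ q = c * 1 := h1
  have h2 : (1 : F) ^ q = c * (ξ : F) ^ k := h2
  rw [mul_one] at h1
  rw [one_pow, ← h1, ← pow_succ, eq_comm] at h2
  exact hk ((pow_norm_eq_one_iff hF hξ k).1 h2)

theorem twistIndex_not_dvd {k : ℕ} (hk : k + 2 < q) : ¬ q - 1 ∣ twistIndex q (k + 1) := by
  rw [twistIndex]
  split_ifs <;> exact fun h => by have := Nat.le_of_dvd (by omega) h; omega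

theorem rep_mem_Sig (hF : Nat.card F = q ^ 2) (hq : Odd q) {ξ : Fˣ}
    (hξ : ∀ x : Fˣ, x ∈ Subgroup.zpowers ξ) (i : Idx q) :
    rep q ξ i ∈ Sig F q ↔ i = .inl 0 ∨ i = .inl 1 ∨ i = .inl 2 := by
  have hq0 := ne_zero_of_card hF
  have hT1 := ptT1_notMem_Sig hF hq hξ
  have hT2 := ptT2_notMem_Sig hF hξ
  rcases i with i | j | k
  · fin_cases i
    · refine iff_of_true ⟨_, _, ⟨0, 0, 1, zero_pow hq0, one_pow _, ?_⟩, rfl⟩ (by simp)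
      simp [hq0]
    · refine iff_of_true ⟨_, _, ⟨1, 0, 1, one_pow _, one_pow _, ?_⟩, rfl⟩ (by simp)
      simp [hq0]
    · refine iff_of_true ⟨_, _, ⟨1, 0, (ξ : F) ^ (q + 1), one_pow _,
        (pow_card_of_dvd hF hq hξ _).2 dvd_rfl, ?_⟩, rfl⟩ (by simp)
      simp [hq0]
    · refine iff_of_false (fun h => ?_) (by simp)
      obtain ⟨c, -, h1, -⟩ := exists_of_mk_mem_Sig hF h
      simp at h1
    · refine iff_of_false ?_ (by simp)
      change (if q % 4 = 1 then ptT1 ξ else ptT2 q ξ) ∉ _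
      split_ifs <;> assumption
    · refine iff_of_false ?_ (by simp)
      change (if q % 4 = 1 then ptT2 q ξ else ptT1 ξ) ∉ _
      split_ifs <;> assumption
  · refine iff_of_false (ptR_notMem_Sig hF hq hξ fun h => ?_) (by simp)
    have := Nat.le_of_dvd (by omega) h
    omega
  · exact iff_of_false (ptQ_notMem_Sig hF hξ (twistIndex_not_dvd (by omega))) (by simp)

theorem trPow_half (ξ : Fˣ) (hF : Nat.card F = q ^ 2) (hq : Odd q)
    (hξ : ∀ x : Fˣ, x ∈ Subgroup.zpowers ξ) :
    trPow ξ ((q ^ 2 - 1) / 2) = -2 := by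
  obtain ⟨n, h0, rfl, hh⟩ := exists_half hF hq
  rw [hh, Nat.mul_div_cancel_left _ two_pos, trPow, pow_half_of_generator hF hξ hh (by positivity)]
  norm_num

/-- The point (0,0,0,1) lies on every surface and U on none; any other representative is off the
quadric and so lies on exactly one. -/
theorem rep_mem_surface (hF : Nat.card F = q ^ 2) (hq : Odd q) {ξ : Fˣ}
    (hξ : ∀ x : Fˣ, x ∈ Subgroup.zpowers ξ) (i : Idx q) (γ : F) :
    rep q ξ i ∈ surface q γ ↔
      i = .inl 0 ∨ (i ≠ .inl 0 ∧ i ≠ .inl 3 ∧ γ = trPow ξ (code q i)) := by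
  have hcode := trPow_half ξ hF hq hξ
  have hT1 := ptT1_mem_surface hF hq ξ (γ := γ)
  have hT2 := ptT2_mem_surface hF hq hξ (γ := γ)
  have hq4 : q % 4 = 1 ∨ q % 4 = 3 := by
    obtain ⟨m, rfl⟩ := hq
    omega
  have hsign : (-1 : F) ^ ((q - 1) / 2) = if q % 4 = 1 then 1 else -1 := by
    split_ifs
    · exact Even.neg_one_pow (by rw [Nat.even_iff]; omega)
    · exact Odd.neg_one_pow (by rw [Nat.odd_iff]; omega)
  rw [hsign] at hT1 hT2
  rcases i with i | j | k
  · fin_cases i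
    · exact iff_of_true (e4_mem_surface hq γ _) (by simp)
    · refine (ptS1_mem_surface hq).trans ?_
      simp [code, trPow_zero]
    · refine (ptS2_mem_surface hF hq hξ).trans ?_
      simp [code, hcode]
    · exact iff_of_false (ptU_notMem_surface hq γ) (by simp)
    · change (if q % 4 = 1 then ptT1 ξ else ptT2 q ξ) ∈ _ ↔ _
      split_ifs at hT1 hT2 ⊢
      · simp [hT1, code, trPow_zero]
      · simp [hT2, code, trPow_zero]
    · change (if q % 4 = 1 then ptT2 q ξ else ptT1 ξ) ∈ _ ↔ _
      split_ifs at hT1 hT2 ⊢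
      · simp [hT2, code, hcode]
      · simp [hT1, code, hcode]
  · refine (ptR_mem_surface hF hq ξ _).trans ?_
    simp [code]
  · refine (twistIndex_mem_surface hF hq hξ (by omega)).trans ?_
    simp [code]

theorem ptR_mem_isSquare (hF : Nat.card F = q ^ 2) (hq : Odd q) {ξ : Fˣ}
    (hξ : ∀ x : Fˣ, x ∈ Subgroup.zpowers ξ) (j : ℕ) :
    ptR ξ j ∈ pointsOf {v : Fin 4 → F | IsSquare (quadForm v)} ↔ Even j := by
  rw [ptR, mk_mem_isSquare, ← isSquare_pow_iff_of_generator hF hq hξ]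
  simp [quadForm]

/-- The value of `quadForm` is -ξ^k, and -1 is a square in the field with q² elements, being an even
power of ξ. -/
theorem ptQ_mem_isSquare (hF : Nat.card F = q ^ 2) (hq : Odd q) {ξ : Fˣ}
    (hξ : ∀ x : Fˣ, x ∈ Subgroup.zpowers ξ) (k : ℕ) :
    ptQ ξ k ∈ pointsOf {v : Fin 4 → F | IsSquare (quadForm v)} ↔ Even k := by
  obtain ⟨n, h0, rfl, hh⟩ := exists_half hF hq
  have h := isSquare_pow_iff_of_generator hF hq hξ (2 * n * (n + 1) + k)
  rw [pow_add, pow_half_of_generator hF hξ hh (by positivity), neg_one_mul, mul_assoc,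
    Nat.even_add, iff_true_left (even_two_mul _)] at h
  rw [ptQ, mk_mem_isSquare, ← h]
  simp [quadForm]

theorem code_le (hF : Nat.card F = q ^ 2) (hq : Odd q) (i : Idx q) :
    code q i ≤ (q ^ 2 - 1) / 2 := by
  obtain ⟨n, h0, rfl, hh⟩ := exists_half hF hq
  rw [hh, Nat.mul_div_cancel_left _ two_pos]
  rcases i with i | ⟨j, hj⟩ | ⟨k, hk⟩
  · fin_cases i <;> simp [code, hh]
  · rw [code, show (2 * n + 1 - 1) / 2 = n by omega]
    calc (j + 1) * n ≤ 2 * (n + 1) * n := Nat.mul_le_mul_right _ (by omega)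
      _ = _ := by ring
  · rw [code, show (2 * n + 1 + 1) / 2 = n + 1 by omega]
    exact Nat.mul_le_mul_right _ (by omega)

theorem trPow_inj_of_le (hF : Nat.card F = q ^ 2) (hq : Odd q) {ξ : Fˣ}
    (hξ : ∀ x : Fˣ, x ∈ Subgroup.zpowers ξ) {e f : ℕ} (he : e ≤ (q ^ 2 - 1) / 2)
    (hf : f ≤ (q ^ 2 - 1) / 2) : trPow ξ e = trPow ξ f ↔ e = f := by
  obtain ⟨n, h0, rfl, hh⟩ := exists_half hF hq
  rw [hh, Nat.mul_div_cancel_left _ two_pos] at he hf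
  exact trPow_inj hF hξ hh he hf

theorem rep_mem_surface_trPow (hF : Nat.card F = q ^ 2) (hq : Odd q) {ξ : Fˣ}
    (hξ : ∀ x : Fˣ, x ∈ Subgroup.zpowers ξ) (i : Idx q) {e : ℕ} (he : e ≤ (q ^ 2 - 1) / 2) :
    rep q ξ i ∈ surface q (trPow ξ e) ↔
      i = .inl 0 ∨ (i ≠ .inl 0 ∧ i ≠ .inl 3 ∧ e = code q i) := by
  rw [rep_mem_surface hF hq hξ, trPow_inj_of_le hF hq hξ he (code_le hF hq i)]

/-- The points `R_j` and `Q_k` have codes strictly between the extreme ones. -/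
theorem code_inr_pos_lt (hF : Nat.card F = q ^ 2) (hq : Odd q) (i : Fin q ⊕ Fin (q - 2)) :
    0 < code q (.inr i) ∧ code q (.inr i) < (q ^ 2 - 1) / 2 := by
  obtain ⟨n, h0, rfl, hh⟩ := exists_half hF hq
  rw [hh, Nat.mul_div_cancel_left _ two_pos]
  rcases i with ⟨j, hj⟩ | ⟨k, hk⟩
  · rw [code, show (2 * n + 1 - 1) / 2 = n by omega]
    refine ⟨by positivity, ?_⟩
    calc (j + 1) * n < 2 * (n + 1) * n := Nat.mul_lt_mul_of_pos_right (by omega) h0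
      _ = _ := by ring
  · rw [code, show (2 * n + 1 + 1) / 2 = n + 1 by omega]
    exact ⟨by positivity, Nat.mul_lt_mul_of_pos_right (by omega) (by omega)⟩

theorem code_R_eq_iff (hF : Nat.card F = q ^ 2) (hq : Odd q) (j : Fin q) (m : ℕ) :
    m * ((q - 1) / 2) = code q (.inr (.inl j)) ↔ m = j + 1 := by
  obtain ⟨n, h0, rfl, hh⟩ := exists_half hF hq
  rw [code, Nat.mul_left_inj (show (2 * n + 1 - 1) / 2 ≠ 0 by omega)]

theorem code_Q_eq_iff (k : Fin (q - 2)) (m : ℕ) :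
    m * ((q + 1) / 2) = code q (.inr (.inr k)) ↔ m = k + 1 := by
  rw [code, Nat.mul_left_inj (show (q + 1) / 2 ≠ 0 by have := k.2; omega)]

/-- The consecutive integers (q - 1)/2 and (q + 1)/2 are coprime, so (q + 1)/2 divides j, and j ≤ q
leaves one multiple. Thus the families S_j and E_k meet only in the Hermitian surface. -/
theorem mul_half_eq_mul_half (hF : Nat.card F = q ^ 2) (hq : Odd q) {j k : ℕ} (hj : 1 ≤ j)
    (hjq : j ≤ q) :
    j * ((q - 1) / 2) = k * ((q + 1) / 2) ↔ j = (q + 1) / 2 ∧ k = (q - 1) / 2 := by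
  obtain ⟨n, h0, rfl, hh⟩ := exists_half hF hq
  rw [show (2 * n + 1 + 1) / 2 = n + 1 by omega, show (2 * n + 1 - 1) / 2 = n by omega]
  refine ⟨fun h => ?_, fun ⟨h1, h2⟩ => by rw [h1, h2, mul_comm]⟩
  have hd : n + 1 ∣ j := (Nat.coprime_self_add_left.2 (Nat.coprime_one_left n)).dvd_of_dvd_mul_right
    (Dvd.intro_left k h.symm)
  obtain ⟨c, rfl⟩ := hd
  have hc : c < 2 := by
    by_contra hc
    have := Nat.mul_le_mul_left (n + 1) (not_lt.1 hc)
    omega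
  obtain rfl : c = 1 := by
    rcases c with _ | _ | c
    · omega
    · rfl
    · omega
  refine ⟨by ring, ?_⟩
  exact Nat.eq_of_mul_eq_mul_right (show 0 < n + 1 by omega) (h.symm.trans (by ring))

theorem twistIndex_half (hq : Odd q) : twistIndex q ((q - 1) / 2) = (q - 1) / 2 := by
  obtain ⟨n, rfl⟩ := hq
  rw [twistIndex]
  split_ifs <;> omega

/-- The quadric, Σ and the parameter γ separate everything except R_{(q+1)/2} and Q_{(q-1)/2}, both
on the Hermitian surface. For these the exponents are consecutive integers, so exactly one has
`quadForm` a square. -/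
theorem rep_inj (hF : Nat.card F = q ^ 2) (hq : Odd q) {ξ : Fˣ}
    (hξ : ∀ x : Fˣ, x ∈ Subgroup.zpowers ξ) (i j : Idx q)
    (h : rep q ξ j ∈ orbit (K hF) (rep q ξ i)) : i = j := by
  have hQ := (isInv_quadric hF).mem_iff_of_orbit h
  have hS := (isInv_Sig hF).mem_iff_of_orbit h
  have hγ := (isInv_surface hF (trPow ξ (code q i))).mem_iff_of_orbit h
  have hsq := (isInv_isSquare hF).mem_iff_of_orbit h
  rw [rep_mem_quadric, rep_mem_quadric] at hQ
  rw [rep_mem_Sig hF hq hξ, rep_mem_Sig hF hq hξ] at hS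
  rw [rep_mem_surface_trPow hF hq hξ _ (code_le hF hq i),
    rep_mem_surface_trPow hF hq hξ _ (code_le hF hq i)] at hγ
  have hh : 0 < (q ^ 2 - 1) / 2 := by
    obtain ⟨n, h0, rfl, hh⟩ := exists_half hF hq
    rw [hh, Nat.mul_div_cancel_left _ two_pos]
    positivity
  have hmid : ∀ (a : Fin q) (b : Fin (q - 2)),
      code q (.inr (.inl a)) = code q (.inr (.inr b)) →
      (rep q ξ (.inr (.inl a)) ∈ pointsOf {v : Fin 4 → F | IsSquare (quadForm v)} ↔
        rep q ξ (.inr (.inr b)) ∈ pointsOf {v : Fin 4 → F | IsSquare (quadForm v)}) → False := by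
    intro a b hab hsq
    obtain ⟨h1, h2⟩ := (mul_half_eq_mul_half hF hq (by omega) (by omega)).1 hab
    rw [rep, rep, h1, h2, twistIndex_half hq, ptR_mem_isSquare hF hq hξ,
      ptQ_mem_isSquare hF hq hξ, Nat.even_iff, Nat.even_iff] at hsq
    omega
  rcases i with i | i
  · rcases j with j | j
    · clear hmid hsq h
      fin_cases i <;> fin_cases j <;> simp [code] at hQ hS hγ ⊢ <;> omega
    · exfalso
      have := code_inr_pos_lt hF hq j
      clear hmid hsq h
      fin_cases i <;> simp [code] at hQ hS hγ <;> simp [code] at this <;> omega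
  · have hi := code_inr_pos_lt hF hq i
    rcases j with j | j
    · exfalso
      clear hmid hsq h
      generalize code q (.inr i) = c at hi hγ
      fin_cases j <;> simp [code] at hQ hS hγ <;> omega
    · have hγ : code q (.inr i) = code q (.inr j) := by simpa using hγ
      rcases i with i | i <;> rcases j with j | j
      · have := (code_R_eq_iff hF hq j (i + 1)).1 hγ
        rw [Fin.ext (Nat.succ_injective this)]
      · exact (hmid i j hγ hsq.symm).elim
      · exact (hmid j i hγ.symm hsq).elim
      · have := (code_Q_eq_iff j (i + 1)).1 hγ
        rw [Fin.ext (Nat.succ_injective this)]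

end Membership

/-! ### Orbit sizes and completeness of the list -/

section Sizes

/-- The orders of the stabilizers of the representatives in `SL(2, q ^ 2)`. -/
def stabOrder (q : ℕ) : Idx q → ℕ
  | .inl i => ![(q ^ 2 - 1) * q ^ 2, 2 * (q * (q ^ 2 - 1)), 2 * (q * (q ^ 2 - 1)), q ^ 2 - 1,
      2 * q, 2 * q] i
  | .inr (.inl _) => 2 * (q + 1)
  | .inr (.inr _) => 2 * (q - 1)

/-- The sizes of the orbits. -/
def size (q : ℕ) : Idx q → ℕ
  | .inl i => ![q ^ 2 + 1, q * ((q ^ 2 + 1) / 2), q * ((q ^ 2 + 1) / 2), q ^ 2 * (q ^ 2 + 1),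
      q * ((q ^ 2 - 1) * ((q ^ 2 + 1) / 2)), q * ((q ^ 2 - 1) * ((q ^ 2 + 1) / 2))] i
  | .inr (.inl _) => q ^ 2 * (q ^ 2 + 1) * ((q - 1) / 2)
  | .inr (.inr _) => q ^ 2 * (q ^ 2 + 1) * ((q + 1) / 2)

theorem half_facts (n : ℕ) :
    (2 * n + 1) ^ 2 - 1 = 4 * n * (n + 1) ∧
    ((2 * n + 1) ^ 2 + 1) / 2 = 2 * n ^ 2 + 2 * n + 1 ∧
    ((2 * n + 1) ^ 2) ^ 2 - 1 = 4 * n * (n + 1) * (2 * (2 * n ^ 2 + 2 * n + 1)) ∧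
    (2 * n + 1 - 1) / 2 = n ∧ (2 * n + 1 + 1) / 2 = n + 1 ∧ 2 * n + 1 - 1 = 2 * n := by
  refine ⟨?_, ?_, ?_, by omega, by omega, by omega⟩
  · rw [show (2 * n + 1) ^ 2 = 4 * n * (n + 1) + 1 by ring, Nat.add_sub_cancel]
  · rw [show (2 * n + 1) ^ 2 + 1 = 2 * (2 * n ^ 2 + 2 * n + 1) by ring,
      Nat.mul_div_cancel_left _ two_pos]
  · rw [show ((2 * n + 1) ^ 2) ^ 2 = 4 * n * (n + 1) * (2 * (2 * n ^ 2 + 2 * n + 1)) + 1 by ring,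
      Nat.add_sub_cancel]

/-- The common product is the order of SL(2, q²), so the stabilizer bounds turn into lower bounds
for orbits. -/
theorem size_mul_stabOrder {q : ℕ} (hq : Odd q) (i : Idx q) :
    size q i * stabOrder q i = q ^ 2 * ((q ^ 2) ^ 2 - 1) := by
  obtain ⟨n, rfl⟩ := hq
  obtain ⟨h1, h2, h3, h4, h5, h6⟩ := half_facts n
  rcases i with i | j | k
  · fin_cases i <;> simp only [size, stabOrder, Fin.zero_eta, Fin.mk_one, Fin.reduceFinMk,
      Matrix.cons_val, h1, h2, h3] <;> ring
  · simp only [size, stabOrder, h3, h4]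
    ring
  · simp only [size, stabOrder, h3, h5, h6]
    ring

theorem stabOrder_pos {q : ℕ} (hq : 1 < q) (i : Idx q) : 0 < stabOrder q i := by
  have h2 : 0 < q ^ 2 - 1 := Nat.sub_pos_of_lt (Nat.one_lt_pow two_ne_zero hq)
  have h3 : 0 < q - 1 := by omega
  rcases i with i | j | k
  · fin_cases i <;> simp only [stabOrder, Fin.zero_eta, Fin.mk_one, Fin.reduceFinMk,
      Matrix.cons_val] <;> positivity
  · simp only [stabOrder]
    positivity
  · simp only [stabOrder]
    positivity

theorem sum_size {q : ℕ} (hq : Odd q) (hq1 : 1 < q) :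
    ∑ i, size q i = (q ^ 2 + 1) * (q ^ 4 + 1) := by
  obtain ⟨n, rfl⟩ := hq
  -- This makes the truncated `q - 2` equal to `2 * m + 1`, so that `ring` applies.
  obtain ⟨m, rfl⟩ : ∃ m, n = m + 1 := ⟨n - 1, by omega⟩
  obtain ⟨h1, h2, h3, h4, h5, h6⟩ := half_facts (m + 1)
  rw [Fintype.sum_sum_type, Fintype.sum_sum_type, Fin.sum_univ_six]
  simp only [size, Matrix.cons_val, Finset.sum_const, Finset.card_univ, Fintype.card_fin,
    smul_eq_mul, h1, h2, h4, h5]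
  rw [show 2 * (m + 1) + 1 - 2 = 2 * m + 1 by omega]
  ring

variable {F : Type*} [Field F] [Finite F] {q : ℕ}

theorem card_stab_rep_le (hF : Nat.card F = q ^ 2) (hq : Odd q) {ξ : Fˣ}
    (hξ : ∀ x : Fˣ, x ∈ Subgroup.zpowers ξ) (i : Idx q) :
    Nat.card (stab hF (rep q ξ i)) ≤ stabOrder q i := by
  have hq1 := one_lt_of_card hF
  have hT1 : Nat.card (stab hF (ptT1 ξ)) ≤ 2 * q := by
    refine card_stab_tangent_le hF hq1 (one_pow _) ?_ _
    rw [one_mul, ← pow_one (ξ : F), Ne, pow_card_of_dvd hF hq hξ]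
    exact fun h => by have := Nat.le_of_dvd one_pos h; omega
  have hT2 : Nat.card (stab hF (ptT2 q ξ)) ≤ 2 * q := by
    have hz := pow_sub_one_norm hF hq hξ
    refine card_stab_tangent_le hF hq1 hz ?_ _
    rw [← pow_succ', hz]
    exact (ptT2_norm_ne hF hξ).symm
  rcases i with i | j | k
  · fin_cases i
    · exact card_stab_e4_le hF _
    · exact card_stab_Sig_le hF (one_pow q) one_ne_zero _
    · exact card_stab_Sig_le hF ((pow_card_of_dvd hF hq hξ _).2 dvd_rfl)
        (pow_ne_zero _ ξ.ne_zero) _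
    · exact card_stab_U_le hF
    · change Nat.card (stab hF (if q % 4 = 1 then ptT1 ξ else ptT2 q ξ)) ≤ 2 * q
      split_ifs <;> assumption
    · change Nat.card (stab hF (if q % 4 = 1 then ptT2 q ξ else ptT1 ξ)) ≤ 2 * q
      split_ifs <;> assumption
  · refine card_stab_secant_le hF (mt (pow_card_of_dvd hF hq hξ _).1 fun h => ?_) _
    have := Nat.le_of_dvd (by omega) h
    omega
  · exact card_stab_external_le hF hq1 (pow_ne_zero _ ξ.ne_zero)
      (mt (pow_norm_eq_one_iff hF hξ _).1 (twistIndex_not_dvd (by omega))) _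

theorem size_le (hF : Nat.card F = q ^ 2) (hq : Odd q) {ξ : Fˣ}
    (hξ : ∀ x : Fˣ, x ∈ Subgroup.zpowers ξ) (i : Idx q) :
    size q i ≤ (orbit (K hF) (rep q ξ i)).ncard := by
  have h1 := card_SL_two_ge hF
  have h2 : Nat.card SL(2, F) = (orbit (K hF) (rep q ξ i)).ncard * _ :=
    card_eq_ncard_orbit_range_mul (toPGL hF) (rep q ξ i)
  refine Nat.le_of_mul_le_mul_right ?_ (stabOrder_pos (one_lt_of_card hF) i)
  rw [size_mul_stabOrder hq]
  exact h1.trans (h2.le.trans (Nat.mul_le_mul_left _ (card_stab_rep_le hF hq hξ i)))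

theorem orbit_classification (hF : Nat.card F = q ^ 2) (hq : Odd q) {ξ : Fˣ}
    (hξ : ∀ x : Fˣ, x ∈ Subgroup.zpowers ξ) :
    (∀ i, (orbit (K hF) (rep q ξ i)).ncard = size q i) ∧
      ∀ P, ∃ i, P ∈ orbit (K hF) (rep q ξ i) :=
  orbits_of_card (rep q ξ) (size q) (rep_inj hF hq hξ) (size_le hF hq hξ)
    (by rw [card_PG3 hF, sum_size hq (one_lt_of_card hF)])

theorem card_orbits (hF : Nat.card F = q ^ 2) (hq : Odd q) {ξ : Fˣ}
    (hξ : ∀ x : Fˣ, x ∈ Subgroup.zpowers ξ) :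
    Nat.card (orbitRel.Quotient (K hF) (PG3 F)) = 2 * q + 4 := by
  have hbij : Function.Bijective
      (fun i => (Quotient.mk (orbitRel (K hF) (PG3 F)) (rep q ξ i))) := by
    constructor
    · intro i j h
      exact (rep_inj hF hq hξ j i (Quotient.exact h)).symm
    · intro x
      induction x using Quotient.inductionOn with
      | h P =>
        obtain ⟨i, hi⟩ := (orbit_classification hF hq hξ).2 P
        exact ⟨i, (Quotient.sound hi).symm⟩
  have := one_lt_of_card hF
  obtain ⟨n, rfl⟩ := hq
  refine (Nat.card_congr (Equiv.ofBijective _ hbij)).symm.trans ?_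
  rw [Nat.card_sum, Nat.card_sum, Nat.card_fin, Nat.card_fin, Nat.card_fin]
  omega

/-- An invariant set is a union of orbits, and every orbit has a representative in the list. -/
theorem IsInv.eq_orbit_union {hF : Nat.card F = q ^ 2} (hq : Odd q) {ξ : Fˣ}
    (hξ : ∀ x : Fˣ, x ∈ Subgroup.zpowers ξ) {X : Set (PG3 F)} (hX : IsInv hF X) (i j : Idx q)
    (h : ∀ k, rep q ξ k ∈ X ↔ k = i ∨ k = j) :
    X = orbit (K hF) (rep q ξ i) ∪ orbit (K hF) (rep q ξ j) := by
  ext P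
  constructor
  · intro hP
    obtain ⟨k, hk⟩ := (orbit_classification hF hq hξ).2 P
    rcases (h k).1 ((hX.mem_iff_of_orbit hk).1 hP) with rfl | rfl
    exacts [Or.inl hk, Or.inr hk]
  · rintro (hP | hP)
    · exact (hX.mem_iff_of_orbit hP).2 ((h i).2 (Or.inl rfl))
    · exact (hX.mem_iff_of_orbit hP).2 ((h j).2 (Or.inr rfl))

theorem IsInv.eq_orbit {hF : Nat.card F = q ^ 2} (hq : Odd q) {ξ : Fˣ}
    (hξ : ∀ x : Fˣ, x ∈ Subgroup.zpowers ξ) {X : Set (PG3 F)} (hX : IsInv hF X) (i : Idx q)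
    (h : ∀ k, rep q ξ k ∈ X ↔ k = i) : X = orbit (K hF) (rep q ξ i) := by
  rw [hX.eq_orbit_union hq hξ i i fun k => by rw [h, or_self], Set.union_self]

theorem isInv_O (hF : Nat.card F = q ^ 2) : IsInv hF (O F q) :=
  O_eq hF ▸ (isInv_quadric hF).inter (isInv_Sig hF)

theorem rep_mem_O (hF : Nat.card F = q ^ 2) (hq : Odd q) {ξ : Fˣ}
    (hξ : ∀ x : Fˣ, x ∈ Subgroup.zpowers ξ) (i : Idx q) :
    rep q ξ i ∈ O F q ↔ i = .inl 0 := by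
  rw [O_eq hF, Set.mem_inter_iff, rep_mem_quadric, rep_mem_Sig hF hq hξ]
  constructor
  · rintro ⟨rfl | rfl, h⟩ <;> simp_all
  · rintro rfl
    simp

theorem rep_mem_surface_diff_O (hF : Nat.card F = q ^ 2) (hq : Odd q) {ξ : Fˣ}
    (hξ : ∀ x : Fˣ, x ∈ Subgroup.zpowers ξ) (i j : Idx q) :
    rep q ξ i ∈ surface q (trPow ξ (code q j)) \ O F q ↔
      i ≠ .inl 0 ∧ i ≠ .inl 3 ∧ code q j = code q i := by
  rw [Set.mem_sdiff, rep_mem_O hF hq hξ, rep_mem_surface_trPow hF hq hξ _ (code_le hF hq j)]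
  tauto

/-- Here `a` and `b` index the two representatives on the Hermitian surface, the only coincidence of
codes among the R_j and Q_k. -/
theorem code_inr_eq_iff (hF : Nat.card F = q ^ 2) (hq : Odd q) {a : Fin q} {b : Fin (q - 2)}
    (ha : (a : ℕ) + 1 = (q + 1) / 2) (hb : (b : ℕ) + 1 = (q - 1) / 2) (x : Fin q ⊕ Fin (q - 2))
    (i : Idx q) :
    code q (.inr x) = code q i ↔ i = .inr x ∨ (x = .inl a ∧ i = .inr (.inr b)) ∨
      (x = .inr b ∧ i = .inr (.inl a)) := by
  have hx := code_inr_pos_lt hF hq x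
  have hmid : ∀ (j : Fin q) (k : Fin (q - 2)),
      code q (.inr (.inl j)) = code q (.inr (.inr k)) ↔ j = a ∧ k = b := by
    intro j k
    refine (mul_half_eq_mul_half hF hq (by omega) (by omega)).trans ?_
    rw [Fin.ext_iff, Fin.ext_iff]
    omega
  rcases i with i | i
  · refine iff_of_false ?_ (by simp)
    generalize code q (.inr x) = c at hx
    fin_cases i <;> simp [code] <;> omega
  · rcases x with j | k <;> rcases i with j' | k'
    · refine (code_R_eq_iff hF hq j' (j + 1)).trans ?_
      simp [Fin.ext_iff, eq_comm]
    · rw [hmid]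
      simp
    · rw [eq_comm, hmid]
      simp [and_comm]
    · refine (code_Q_eq_iff k' (k + 1)).trans ?_
      simp [Fin.ext_iff, eq_comm]

end Sizes

/-! ### The geometric sets as orbits -/

section Identification

variable {F : Type*} [Field F] [Finite F] {q : ℕ}

theorem surface_diff_O_eq (hF : Nat.card F = q ^ 2) (hq : Odd q) {ξ : Fˣ}
    (hξ : ∀ x : Fˣ, x ∈ Subgroup.zpowers ξ) {a : Fin q} {b : Fin (q - 2)}
    (ha : (a : ℕ) + 1 = (q + 1) / 2) (hb : (b : ℕ) + 1 = (q - 1) / 2) {x : Fin q ⊕ Fin (q - 2)}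
    (hxa : x ≠ .inl a) (hxb : x ≠ .inr b) :
    surface q (trPow ξ (code q (.inr x))) \ O F q = orbit (K hF) (rep q ξ (.inr x)) := by
  refine ((isInv_surface hF _).diff (isInv_O hF)).eq_orbit hq hξ _ fun k => ?_
  rw [rep_mem_surface_diff_O hF hq hξ, code_inr_eq_iff hF hq ha hb]
  constructor
  · simp [hxa, hxb]
  · rintro rfl
    simp

/-- The code of R_{(q+1)/2} is (q² - 1)/4, so ξ to that power has square -1 and its trace vanishes.
-/
theorem hermSurface_diff_O_eq (hF : Nat.card F = q ^ 2) (hq : Odd q) {ξ : Fˣ}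
    (hξ : ∀ x : Fˣ, x ∈ Subgroup.zpowers ξ) {a : Fin q} {b : Fin (q - 2)}
    (ha : (a : ℕ) + 1 = (q + 1) / 2) (hb : (b : ℕ) + 1 = (q - 1) / 2) :
    hermSurface F q \ O F q =
      orbit (K hF) (rep q ξ (.inr (.inl a))) ∪ orbit (K hF) (rep q ξ (.inr (.inr b))) := by
  have h0 : trPow ξ (code q (.inr (.inl a))) = 0 := by
    obtain ⟨n, h0, rfl, hh⟩ := exists_half hF hq
    rw [code, ha, show (2 * n + 1 + 1) / 2 = n + 1 by omega, show (2 * n + 1 - 1) / 2 = n by omega,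
      trPow]
    have h1 := pow_half_of_generator hF hξ hh (by positivity)
    rw [show 2 * n * (n + 1) = (n + 1) * n * 2 by ring, pow_mul] at h1
    have := pow_ne_zero ((n + 1) * n) ξ.ne_zero
    field_simp
    rw [h1, neg_add_cancel, mul_zero]
  rw [hermSurface_eq, ← h0]
  refine ((isInv_surface hF _).diff (isInv_O hF)).eq_orbit_union hq hξ _ _ fun k => ?_
  rw [rep_mem_surface_diff_O hF hq hξ, code_inr_eq_iff hF hq ha hb]
  constructor
  · simp
  · rintro (rfl | rfl) <;> simp

/-- Besides the curve, E_0 also contains S₁ and E_{q-1} also contains S₂, so all of Σ is removed to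
leave a single orbit. -/
theorem surface_diff_Sig_eq (hF : Nat.card F = q ^ 2) (hq : Odd q) {ξ : Fˣ}
    (hξ : ∀ x : Fˣ, x ∈ Subgroup.zpowers ξ) {i : Fin 6} (hi : i = 4 ∨ i = 5) :
    surface q (trPow ξ (code q (.inl i))) \ Sig F q = orbit (K hF) (rep q ξ (.inl i)) := by
  refine ((isInv_surface hF _).diff (isInv_Sig hF)).eq_orbit hq hξ _ fun k => ?_
  rw [Set.mem_sdiff, rep_mem_surface_trPow hF hq hξ _ (code_le hF hq _), rep_mem_Sig hF hq hξ]
  constructor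
  · rintro ⟨h1, h2⟩
    rcases k with k | k
    · have hq1 := one_lt_of_card hF
      have : 0 < (q ^ 2 - 1) / 2 := Nat.div_pos (by
        have : 2 ^ 2 ≤ q ^ 2 := Nat.pow_le_pow_left hq1 2
        omega) two_pos
      rcases hi with rfl | rfl <;> fin_cases k <;> simp [code] at h1 h2 ⊢ <;> omega
    · have := code_inr_pos_lt hF hq k
      simp only [reduceCtorEq, ne_eq, not_false_eq_true, true_and, false_or] at h1
      rw [← h1] at this
      rcases hi with rfl | rfl <;> simp [code] at this
  · rintro rfl
    rcases hi with rfl | rfl <;> simp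

theorem quadric_diff_O_eq (hF : Nat.card F = q ^ 2) (hq : Odd q) {ξ : Fˣ}
    (hξ : ∀ x : Fˣ, x ∈ Subgroup.zpowers ξ) :
    quadric F \ O F q = orbit (K hF) (rep q ξ (.inl 3)) := by
  refine ((isInv_quadric hF).diff (isInv_O hF)).eq_orbit hq hξ _ fun k => ?_
  rw [Set.mem_sdiff, rep_mem_quadric, rep_mem_O hF hq hξ]
  constructor
  · tauto
  · rintro rfl
    simp

theorem O_eq_orbit (hF : Nat.card F = q ^ 2) (hq : Odd q) {ξ : Fˣ}
    (hξ : ∀ x : Fˣ, x ∈ Subgroup.zpowers ξ) :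
    O F q = orbit (K hF) (rep q ξ (.inl 0)) :=
  (isInv_O hF).eq_orbit hq hξ _ (rep_mem_O hF hq hξ)

theorem Sig_diff_O_eq (hF : Nat.card F = q ^ 2) (hq : Odd q) {ξ : Fˣ}
    (hξ : ∀ x : Fˣ, x ∈ Subgroup.zpowers ξ) :
    Sig F q \ O F q = Sig1 hF ∪ Sig2 hF ξ := by
  refine ((isInv_Sig hF).diff (isInv_O hF)).eq_orbit_union hq hξ (.inl 1) (.inl 2) fun k => ?_
  rw [Set.mem_sdiff, rep_mem_Sig hF hq hξ, rep_mem_O hF hq hξ]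
  constructor
  · tauto
  · rintro (rfl | rfl) <;> simp

theorem orbit_rep_ne (hF : Nat.card F = q ^ 2) (hq : Odd q) {ξ : Fˣ}
    (hξ : ∀ x : Fˣ, x ∈ Subgroup.zpowers ξ) {i j : Idx q} (hij : i ≠ j) :
    orbit (K hF) (rep q ξ i) ≠ orbit (K hF) (rep q ξ j) :=
  fun h => hij (rep_inj hF hq hξ i j (orbit_eq_iff.1 h.symm))

end Identification

end HermitianVeronese

/-! ### Assembly of the orbit theorem -/

theorem mainTheorem2 {F : Type*} [Field F] [Finite F] {q : ℕ} (hq : Odd q)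
    (hF : Nat.card F = q ^ 2) (ξ : Fˣ) (hξ : ∀ x : Fˣ, x ∈ Subgroup.zpowers ξ) :
    -- the group
    Nonempty (K hF ≃* PSL(2, F)) ∧
    -- the number of orbits
    Nat.card (orbitRel.Quotient (K hF) (PG3 F)) = 2 * q + 4 ∧
    -- the list of all orbits
    Set.range (fun P : PG3 F => orbit (K hF) P) =
      {O F q, Sig1 hF, Sig2 hF ξ, quadric F \ O F q, H1 hF ξ, H2 hF ξ,
        E q ξ 0 \ Sig F q, E q ξ (q - 1) \ Sig F q}
      ∪ (fun j => S q ξ j \ O F q) '' indexS q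
      ∪ (fun k => E q ξ k \ O F q) '' indexE q ∧
    -- O
    (O F q).ncard = q ^ 2 + 1 ∧
    -- the two orbits on the points of Σ outside O
    Sig1 hF ≠ Sig2 hF ξ ∧ Sig1 hF ∪ Sig2 hF ξ = Sig F q \ O F q ∧
    2 * (Sig1 hF).ncard = q * (q ^ 2 + 1) ∧ 2 * (Sig2 hF ξ).ncard = q * (q ^ 2 + 1) ∧
    -- the quadric
    quadric F \ O F q = orbit (K hF) (ptU F) ∧
    (quadric F \ O F q).ncard = q ^ 2 * (q ^ 2 + 1) ∧
    -- the two orbits on the points of the Hermitian surface outside O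
    H1 hF ξ ≠ H2 hF ξ ∧ H1 hF ξ ∪ H2 hF ξ = hermSurface F q \ O F q ∧
    2 * (H1 hF ξ).ncard = q ^ 2 * (q ^ 2 + 1) * (q - 1) ∧
    2 * (H2 hF ξ).ncard = q ^ 2 * (q ^ 2 + 1) * (q + 1) ∧
    -- the surfaces S_j
    (∀ j ∈ indexS q, S q ξ j \ O F q = orbit (K hF) (ptR ξ j) ∧
      2 * (S q ξ j \ O F q).ncard = q ^ 2 * (q ^ 2 + 1) * (q - 1)) ∧
    -- the surfaces E_k
    (∀ k ∈ indexE q,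
      (q % 4 = 1 → E q ξ k \ O F q = orbit (K hF) (ptQ ξ k)) ∧
      (q % 4 = 3 → E q ξ (q - 1 - k) \ O F q = orbit (K hF) (ptQ ξ k)) ∧
      2 * (E q ξ k \ O F q).ncard = q ^ 2 * (q ^ 2 + 1) * (q + 1)) ∧
    -- the surfaces E_0 and E_{q-1}
    (q % 4 = 1 → E q ξ 0 \ Sig F q = orbit (K hF) (ptT1 ξ) ∧
      E q ξ (q - 1) \ Sig F q = orbit (K hF) (ptT2 q ξ)) ∧
    (q % 4 = 3 → E q ξ 0 \ Sig F q = orbit (K hF) (ptT2 q ξ) ∧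
      E q ξ (q - 1) \ Sig F q = orbit (K hF) (ptT1 ξ)) ∧
    2 * (E q ξ 0 \ Sig F q).ncard = q * (q ^ 4 - 1) ∧
    2 * (E q ξ (q - 1) \ Sig F q).ncard = q * (q ^ 4 - 1) := by
  have hq1 := one_lt_of_card hF
  have hmid : (q + 1) / 2 ≤ q ∧ 1 ≤ (q - 1) / 2 ∧ (q - 1) / 2 ≤ q - 2 ∧
      2 * ((q - 1) / 2) = q - 1 ∧ 2 * ((q + 1) / 2) = q + 1 := by
    obtain ⟨n, rfl⟩ := hq
    omega
  obtain ⟨hm1, hm2, hm3, hm4, hm5⟩ := hmid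
  have hs2 : 2 * ((q ^ 2 + 1) / 2) = q ^ 2 + 1 := by
    obtain ⟨n, rfl⟩ := hq
    rw [(half_facts n).2.1]
    ring
  have hs4 : q ^ 4 - 1 = (q ^ 2 - 1) * (q ^ 2 + 1) := by
    rw [mul_comm, ← Nat.sq_sub_sq, ← pow_mul, one_pow]
  -- Indices in `Fin` start at 0 and the labels j, k at 1, so `a` and `b` stand for R_{(q+1)/2} and
  -- Q_{(q-1)/2}.
  let a : Fin q := ⟨(q + 1) / 2 - 1, by omega⟩
  let b : Fin (q - 2) := ⟨(q - 1) / 2 - 1, by omega⟩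
  have ha : (a : ℕ) + 1 = (q + 1) / 2 := Nat.sub_add_cancel (by omega)
  have hb : (b : ℕ) + 1 = (q - 1) / 2 := Nat.sub_add_cancel hm2
  have hsize := (orbit_classification hF hq hξ).1
  have hall := (orbit_classification hF hq hξ).2
  have hO := O_eq_orbit hF hq hξ
  have hU := quadric_diff_O_eq hF hq hξ
  have hSig1 : Sig1 hF = orbit (K hF) (rep q ξ (.inl 1)) := rfl
  have hSig2 : Sig2 hF ξ = orbit (K hF) (rep q ξ (.inl 2)) := rfl
  have hH1 : H1 hF ξ = orbit (K hF) (rep q ξ (.inr (.inl a))) := by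
    rw [rep, ha, H1]
  have hH2 : H2 hF ξ = orbit (K hF) (rep q ξ (.inr (.inr b))) := by
    rw [rep, hb, twistIndex_half hq, H2]
  have hE0 : E q ξ 0 \ Sig F q = orbit (K hF) (rep q ξ (.inl 4)) := by
    rw [← surface_diff_Sig_eq hF hq hξ (Or.inl rfl), E, zero_mul]
    rfl
  have hE1 : E q ξ (q - 1) \ Sig F q = orbit (K hF) (rep q ξ (.inl 5)) := by
    rw [← surface_diff_Sig_eq hF hq hξ (Or.inr rfl), E]
    have : (q - 1) * ((q + 1) / 2) = code q (.inl 5) := by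
      refine Nat.eq_of_mul_eq_mul_left two_pos ?_
      obtain ⟨n, rfl⟩ := hq
      obtain ⟨h1, -, -, -, h5, h6⟩ := half_facts n
      change _ = 2 * (((2 * n + 1) ^ 2 - 1) / 2)
      rw [h1, h5, h6, show 4 * n * (n + 1) = 2 * (2 * n * (n + 1)) by ring,
        Nat.mul_div_cancel_left _ two_pos]
    rw [this]
    rfl
  have hS : ∀ j (hj : j ∈ indexS q), S q ξ j \ O F q =
      orbit (K hF) (rep q ξ (.inr (.inl ⟨j - 1, by have := hj.1.1; have := hj.1.2; omega⟩))) := by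
    rintro j ⟨⟨hj1, hj2⟩, hj3⟩
    have hj3 : j ≠ (q + 1) / 2 := hj3
    rw [← surface_diff_O_eq hF hq hξ ha hb (by simp [a]; omega) (by simp), code,
      Nat.sub_add_cancel hj1]
    rfl
  have hE : ∀ k (hk : k ∈ indexE q), E q ξ k \ O F q =
      orbit (K hF) (rep q ξ (.inr (.inr ⟨k - 1, by have := hk.1.1; have := hk.1.2; omega⟩))) := by
    rintro k ⟨⟨hk1, hk2⟩, hk3⟩
    have hk3 : k ≠ (q - 1) / 2 := hk3
    rw [← surface_diff_O_eq hF hq hξ ha hb (by simp) (by simp [b]; omega), code,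
      Nat.sub_add_cancel hk1]
    rfl
  have hEpt : ∀ k ∈ indexE q, E q ξ k \ O F q = orbit (K hF) (ptQ ξ (twistIndex q k)) := by
    intro k hk
    rw [hE k hk, rep, Nat.sub_add_cancel hk.1.1]
  have hsizeR : ∀ j, 2 * size q (.inr (.inl j)) = q ^ 2 * (q ^ 2 + 1) * (q - 1) := fun j => by
    rw [size, mul_left_comm, hm4]
  have hsizeQ : ∀ k, 2 * size q (.inr (.inr k)) = q ^ 2 * (q ^ 2 + 1) * (q + 1) := fun k => by
    rw [size, mul_left_comm, hm5]
  have hsizeSig : 2 * (q * ((q ^ 2 + 1) / 2)) = q * (q ^ 2 + 1) := by rw [mul_left_comm, hs2]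
  have hsizeT : 2 * (q * ((q ^ 2 - 1) * ((q ^ 2 + 1) / 2))) = q * (q ^ 4 - 1) := by
    rw [mul_left_comm, mul_left_comm 2, hs2, hs4]
  refine ⟨nonempty_K_mulEquiv hF hq, card_orbits hF hq hξ, ?_, ?_, ?_, ?_, ?_, ?_, hU, ?_, ?_, ?_,
    ?_, ?_, ?_, ?_, ?_, ?_, ?_, ?_⟩
  · ext X
    constructor
    · rintro ⟨P, rfl⟩
      obtain ⟨i, hi⟩ := hall P
      change orbit (K hF) P ∈ _
      rw [orbit_eq_iff.2 hi]
      rcases i with i | j | k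
      · left; left
        rw [hU, hO, hSig1, hSig2, hE0, hE1]
        fin_cases i <;> simp
      · by_cases hj : (j : ℕ) + 1 = (q + 1) / 2
        · left; left
          obtain rfl : j = a := Fin.ext (by omega)
          rw [← hH1]
          simp
        · left; right
          have hj' : (j : ℕ) + 1 ∈ indexS q := ⟨⟨by omega, by omega⟩, hj⟩
          exact ⟨j + 1, hj', hS _ hj'⟩
      · by_cases hk : (k : ℕ) + 1 = (q - 1) / 2
        · left; left
          obtain rfl : k = b := Fin.ext (by omega)
          rw [← hH2]
          simp
        · right
          have hk' : (k : ℕ) + 1 ∈ indexE q := ⟨⟨by omega, by omega⟩, hk⟩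
          exact ⟨k + 1, hk', hE _ hk'⟩
    · rintro ((h | ⟨j, hj, rfl⟩) | ⟨k, hk, rfl⟩)
      · rcases h with h | h | h | h | h | h | h | h <;> rw [h]
        exacts [⟨_, hO.symm⟩, ⟨_, rfl⟩, ⟨_, rfl⟩, ⟨_, hU.symm⟩, ⟨_, rfl⟩, ⟨_, rfl⟩,
          ⟨_, hE0.symm⟩, ⟨_, hE1.symm⟩]
      · exact ⟨_, (hS j hj).symm⟩
      · exact ⟨_, (hE k hk).symm⟩
  · rw [hO, hsize]
    rfl
  · exact orbit_rep_ne hF hq hξ (i := .inl 1) (j := .inl 2) (by simp)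
  · exact (Sig_diff_O_eq hF hq hξ).symm
  · rw [hSig1, hsize]
    exact hsizeSig
  · rw [hSig2, hsize]
    exact hsizeSig
  · rw [hU, hsize]
    rfl
  · rw [hH1, hH2]
    exact orbit_rep_ne hF hq hξ (by simp)
  · rw [hermSurface_diff_O_eq hF hq hξ ha hb, hH1, hH2]
  · rw [hH1, hsize, hsizeR]
  · rw [hH2, hsize, hsizeQ]
  · intro j hj
    rw [hS j hj, hsize, hsizeR, rep, Nat.sub_add_cancel hj.1.1]
    exact ⟨rfl, rfl⟩
  · intro k hk
    refine ⟨fun h4 => ?_, fun h4 => ?_, ?_⟩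
    · rw [hEpt k hk, twistIndex, if_pos h4]
    · obtain ⟨⟨hk1, hk2⟩, hk3⟩ := hk
      have hk3 : k ≠ (q - 1) / 2 := hk3
      -- The reflection k ↦ q - 1 - k preserves `indexE q` and is an involution, so the surface with
      -- reflected index has representative Q_k.
      rw [hEpt (q - 1 - k) ⟨⟨by omega, by omega⟩, show q - 1 - k ≠ (q - 1) / 2 by omega⟩,
        twistIndex, if_neg (by omega), Nat.sub_sub_self (by omega)]
    · rw [hE k hk, hsize, hsizeQ]
  · intro h4
    rw [hE0, hE1]
    simp [rep, h4]
  · intro h4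
    rw [hE0, hE1]
    simp [rep, h4]
  · rw [hE0, hsize]
    exact hsizeT
  · rw [hE1, hsize]
    exact hsizeT
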